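/- Let $n$ be the number of vertices, $V$ the vertex set, $|V|=n$. A topological order of a directed acyclic graph (DAG) on $V$ is a bijection $T:V\to\{1,\dots,n\}$ with $T(u)<T(v)$ for every edge $u\to v$. With respect to the current order $T$ write $u<v$ for $T(u)<T(v)$ and $d(u,v)=|T(v)-T(u)|$. Let $p\ge 0$ be an integer and let $t_0,\dots,t_{p+1}$ be reals with $\sqrt n<t_0<t_1<\dots<t_p<t_{p+1}=n$. For $u,v\in V$ and $0\le j\le p+1$ put $$\hat A_j=\{w: u\to w,\ d(u,w)\le t_j,\ w<v\},\qquad \hat B_j=\{w: w\to v,\ d(w,v)\le t_j,\ w>u\}.$$ The algorithm maintains a topological order $T$ of a growing DAG. It starts with a DAG and a topological order of it. To insert an edge $(u,v)$, it calls $\textsc{Reorder}(v,u,0,0)$ if $v\le u$ (and leaves $T$ unchanged otherwise), and then adds the edge to the graph. The procedure $\textsc{Reorder}(u,v,f_1,f_2)$ is as follows. 1. If $v\le u$, exit. 2. If $t_i<d(u,v)\le t_{i+1}$ for some $i\in\{0,\dots,p\}$, compute $\hat A_i$ and $\hat B_i$. If $\hat A_i\ne\emptyset$ or $f_1=1$,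 set $A=\hat A_i$; otherwise also compute $\hat A_{i+1}$ and set $A=\hat A_{i+1}$. If $\hat B_i\ne\emptyset$ or $f_2=1$, set $B=\hat B_i$; otherwise also compute $\hat B_{i+1}$ and set $B=\hat B_{i+1}$. 3. Otherwise (that is, if $d(u,v)\le t_0$), compute $A=\hat A_0$ and $B=\hat B_0$. 4. If $A=B=\emptyset$, swap $u$ and $v$ in $T$ and exit. Otherwise, for each $u'\in\{u\}\cup A$ in decreasing order, and for each $v'\in B\cup\{v\}$ with $v'>u'$ in increasing order, call $\textsc{Reorder}(u',v',f_1',f_2')$, where $f_1'=1$ if and only if $u'=u$ and $A=\emptyset$, and $f_2'=1$ if and only if $v'=v$ and $B=\emptyset$. In these two loops "$v'>u'$" and the increasing and decreasing orders refer to the order $T$ at the start of the execution of $\textsc{Reorder}(u,v,f_1,f_2)$. **Theorem.** There is an absolute constant $C>0$ such that the following holds for all $n$, $p$, $t_0,\dots,t_{p+1}$ as above, every starting DAG with a topological order, and every finite sequence of edges whose insertion keeps the graph acyclic: the algorithm terminates, and for every $i\in\{0,\dots,p\}$, over the whole insertion sequence, the number of calls of $\textsc{Reorder}$ (recursive calls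 included) in which both $\hat A_i$ and $\hat A_{i+1}$ are computed is at most $$C\cdot\frac{n^2\sqrt{t_{i+1}}}{t_i},$$ and the number of calls of $\textsc{Reorder}$ in which both $\hat B_i$ and $\hat B_{i+1}$ are computed is at most the same bound. -/

import Mathlib

namespace OnlineTopSort

/-- The (topological) orders are the bijections of the vertex set onto the positions
`0, …, n - 1`; only comparisons and differences of positions are used. -/
abbrev Order (V : Type*) (n : ℕ) := V ≃ Fin n

/-- `d(u,v) = |T(v) - T(u)|`. -/
def posDist {V : Type*} {n : ℕ} (T : Order V n) (u v : V) : ℝ :=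
  |((T v : ℕ) : ℝ) - ((T u : ℕ) : ℝ)|

/-- `T` is a valid topological order of the digraph with edge relation `E`. -/
def IsTopOrder {V : Type*} {n : ℕ} (E : V → V → Prop) (T : Order V n) : Prop :=
  ∀ a b, E a b → T a < T b

/-- The digraph with edge relation `E` has no directed cycle (in particular no loop). -/
def Acyclic {V : Type*} (E : V → V → Prop) : Prop :=
  ∀ a, ¬ Relation.TransGen E a a

/-- The arguments `(u, v, f₁, f₂)` of a call of `Reorder`. -/
structure Call (V : Type*) where
  u : V
  v : V
  f₁ : Bool
  f₂ : Bool

/-- What is recorded about an executed call of `Reorder`: its arguments, the set of the `j` for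
which it computes `Â_j` and the set of the `j` for which it computes `B̂_j`. (This is about the
body of the call itself; each recursive call made by it has a record of its own.) -/
structure CallRecord (V : Type*) where
  call : Call V
  computedA : Finset ℕ
  computedB : Finset ℕ

/-- The result of running (part of) the algorithm: the order at the end, and the records of all
calls of `Reorder` executed meanwhile. -/
abbrev Outcome (V : Type*) (n : ℕ) := Order V n × List (CallRecord V)

section Algorithm

variable {V : Type*} [Fintype V] {n : ℕ}

open Classical in
/-- `Â_j = {w : u → w, d(u,w) ≤ t_j, w < v}`. -/
noncomputable def hatA (E : V → V → Prop) (t : ℕ → ℝ) (T : Order V n) (u v : V) (j : ℕ) :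
    Finset V :=
  Finset.univ.filter fun w => E u w ∧ posDist T u w ≤ t j ∧ T w < T v

open Classical in
/-- `B̂_j = {w : w → v, d(w,v) ≤ t_j, w > u}`. -/
noncomputable def hatB (E : V → V → Prop) (t : ℕ → ℝ) (T : Order V n) (u v : V) (j : ℕ) :
    Finset V :=
  Finset.univ.filter fun w => E w v ∧ posDist T w v ≤ t j ∧ T u < T w

open Classical in
/-- The `i ∈ {0, …, p}` with `t_i < d ≤ t_{i+1}`, if there is one. -/
noncomputable def level (p : ℕ) (t : ℕ → ℝ) (d : ℝ) : Option ℕ :=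
  (List.range (p + 1)).find? fun i => decide (t i < d ∧ d ≤ t (i + 1))

open Classical in
/-- The common selection rule for `A` (with `S = Â`, `f = f₁`) and for `B` (with `S = B̂`,
`f = f₂`): the chosen set, together with the set of the indices `j` for which `S j` is computed. -/
noncomputable def select (lev : Option ℕ) (f : Bool) (S : ℕ → Finset V) :
    Finset V × Finset ℕ :=
  match lev with
  | some i => if S i ≠ ∅ ∨ f = true then (S i, {i}) else (S (i + 1), {i, i + 1})
  | none => (S 0, {0})

open Classical in
/-- The elements of `S`, listed in increasing order with respect to `T`. -/
noncomputable def increasing (T : Order V n) (S : Finset V) : List V :=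
  ((List.finRange n).map T.symm).filter fun w => decide (w ∈ S)

open Classical in
/-- The recursive calls of the two nested loops, in the order in which they are made: `u'` runs
through `{u} ∪ A` in decreasing order, and for each `u'`, `v'` runs through the `v' > u'` in
`B ∪ {v}` in increasing order, where the order is the one at the start of the calling procedure. -/
noncomputable def recursiveCalls (T : Order V n) (u v : V) (A B : Finset V) : List (Call V) :=
  (increasing T (insert u A)).reverse.flatMap fun u' =>
    ((increasing T (insert v B)).filter fun v' => decide (T u' < T v')).map fun v' =>
      { u := u'
        v := v'
        f₁ := decide (u' = u ∧ A = ∅)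
        f₂ := decide (v' = v ∧ B = ∅) }

/-- Executes a list of calls one after the other by means of `exec`. -/
def runCalls (exec : Order V n → Call V → Option (Outcome V n)) :
    Order V n → List (Call V) → Option (Outcome V n)
  | T, [] => some (T, [])
  | T, c :: cs =>
    (exec T c).bind fun r => (runCalls exec r.1 cs).map fun s => (s.1, r.2 ++ s.2)

open Classical in
/-- The procedure `Reorder(u, v, f₁, f₂)`, on the graph `E`, with the current order `T`. The first
numeral bounds the depth of the recursion: the result is `none` if the execution needs a recursion
of greater depth, and otherwise it is the outcome of the execution, whatever the bound. -/
noncomputable def reorder (E : V → V → Prop) (p : ℕ) (t : ℕ → ℝ) :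
    ℕ → Order V n → Call V → Option (Outcome V n)
  | 0, _, _ => none
  | depth + 1, T, c =>
    if T c.v ≤ T c.u then
      some (T, [{ call := c, computedA := ∅, computedB := ∅ }])
    else
      let lev := level p t (posDist T c.u c.v)
      let a := select lev c.f₁ (hatA E t T c.u c.v)
      let b := select lev c.f₂ (hatB E t T c.u c.v)
      let record : CallRecord V := { call := c, computedA := a.2, computedB := b.2 }
      if a.1 = ∅ ∧ b.1 = ∅ then
        some ((Equiv.swap c.u c.v).trans T, [record])
      else
        (runCalls (reorder E p t depth) T (recursiveCalls T c.u c.v a.1 b.1)).map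
          fun r => (r.1, record :: r.2)

open Classical in
/-- The part of `Insert(u, v)` that updates the order: calls `Reorder(v, u, 0, 0)` if `v ≤ u`. -/
noncomputable def insertEdge (E : V → V → Prop) (p : ℕ) (t : ℕ → ℝ) (depth : ℕ) (T : Order V n)
    (u v : V) : Option (Outcome V n) :=
  if T v ≤ T u then reorder E p t depth T { u := v, v := u, f₁ := false, f₂ := false }
  else some (T, [])

/-- Inserts the edges of a list one after the other, starting from the graph `E` and the order
`T`. The outcome records the calls of `Reorder` over the whole insertion sequence. -/
noncomputable def insertEdges (p : ℕ) (t : ℕ → ℝ) (depth : ℕ) :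
    (V → V → Prop) → Order V n → List (V × V) → Option (Outcome V n)
  | _, T, [] => some (T, [])
  | E, T, e :: es =>
    (insertEdge E p t depth T e.1 e.2).bind fun r =>
      (insertEdges p t depth (fun a b => E a b ∨ (a = e.1 ∧ b = e.2)) r.1 es).map
        fun s => (s.1, r.2 ++ s.2)

end Algorithm

/-- The number of recorded calls that compute both `Â_i` and `Â_{i+1}`. -/
def countBothA {V : Type*} (i : ℕ) (log : List (CallRecord V)) : ℕ :=
  log.countP fun r => decide (i ∈ r.computedA ∧ i + 1 ∈ r.computedA)

/-- The number of recorded calls that compute both `B̂_i` and `B̂_{i+1}`. -/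
def countBothB {V : Type*} (i : ℕ) (log : List (CallRecord V)) : ℕ :=
  log.countP fun r => decide (i ∈ r.computedB ∧ i + 1 ∈ r.computedB)

end OnlineTopSort

/-! Fix a topological order `F` of the final graph. While an edge `a → b` is inserted, every call
has its lower end among the descendants of `b` and its upper end among the ancestors of `a`. These
two cones are disjoint, and a swap moves a descendant of `b` up and an ancestor of `a` down. So the
order stays topological, and a pair of an ancestor and a descendant, once in the right order, is
never reversed.

For `b = t (i + 1)` and `k = n / √b` the potential is `b` times the number of settled pairs at
`F`-distance at most `k`, plus `(∑ x, T x * F x) / k`. Swapping `u` and `v` over a distance `d` adds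
`d * (F u - F v)` to the sum. If `F u - F v > k`, the second term gains at least `d`; otherwise a
new close pair is settled and the first term gains at least `b`, which suffices when `d ≤ b`
(`isWeight_potential`). The potential lies between `0` and `2 n² √b` (`potential_le`).

A call that computes both `Â_i` and `Â_{i+1}` finds the former empty, while the latter contains all
successors of `u` below `v`. They are all farther than `t i`, and so is `v`, so the call moves `u`
by more than `t i`. This move takes place in recursive calls with lower end `u`, made when the
successors of `u` are out of the way. For such a call the move of `u` is at most the gain of
potential, and so is `t i` times its own count. One share of the gain thus pays for the counted
calls inside and a second one for the call itself: `t i * count ≤ 2 * gain` (`reorder_counted`).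
Between insertions the settled pairs become reachable pairs of the new graph, so the gains telescope
(`insertEdges_spec`).

Termination holds because every completed call with `u < v` makes at least one swap, which increases
the bounded quantity `∑ x, T x * F x`. Reversing order and edges exchanges `A` and `B`; a Boolean
side `s` handles both at once. -/

namespace OnlineTopSort

/-! ### Two-sided notation, cones, and the effect of swaps. -/

section Sides

variable {V : Type*} {n : ℕ}

/-- The position of `x`, read upwards (`true`) or downwards (`false`). -/
def pos : Bool → Order V n → V → ℤ
  | true, T, x => ((T x : ℕ) : ℤ)
  | false, T, x => -((T x : ℕ) : ℤ)

/-- The edge relation, read forwards (`true`) or backwards (`false`). -/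
def Rel : Bool → (V → V → Prop) → V → V → Prop
  | true, E, a, b => E a b
  | false, E, a, b => E b a

/-- The lower end (`true`) or the upper end (`false`) of a call. -/
def Call.tip (c : Call V) : Bool → V
  | true => c.u
  | false => c.v

/-- The flag of a call that belongs to one of its ends. -/
def Call.flag (c : Call V) : Bool → Bool
  | true => c.f₁
  | false => c.f₂

lemma pos_not (s : Bool) (T : Order V n) (x : V) : pos (!s) T x = -pos s T x := by
  cases s <;> simp [pos]

lemma pos_congr {s : Bool} {T T' : Order V n} {x y : V} (h : T x = T' y) :
    pos s T x = pos s T' y := by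
  cases s <;> simp [pos, h]

lemma eq_of_pos_eq {s : Bool} {T T' : Order V n} {x y : V} (h : pos s T x = pos s T' y) :
    T x = T' y := by
  apply Fin.ext
  cases s <;> simp [pos] at h <;> omega

lemma pos_true_lt {T T' : Order V n} {x y : V} : pos true T x < pos true T' y ↔ T x < T' y := by
  simp [pos]

lemma pos_false_lt {T T' : Order V n} {x y : V} : pos false T x < pos false T' y ↔ T' y < T x := by
  simp [pos]

lemma pos_tip_lt {T : Order V n} {c : Call V} (s : Bool) :
    pos s T (c.tip s) < pos s T (c.tip !s) ↔ T c.u < T c.v := by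
  cases s <;> simp [pos, Call.tip]

lemma pos_tip_gt {T : Order V n} {c : Call V} (s : Bool) :
    pos s T (c.tip !s) < pos s T (c.tip s) ↔ T c.v < T c.u := by
  cases s <;> simp [pos, Call.tip]

lemma IsTopOrder.pos_lt {E : V → V → Prop} {T : Order V n} (h : IsTopOrder E T) {s : Bool}
    {a b : V} (hab : Rel s E a b) : pos s T a < pos s T b := by
  cases s
  · exact pos_false_lt.2 (h _ _ hab)
  · exact pos_true_lt.2 (h _ _ hab)

/-- `K true` is closed under successors, `K false` under predecessors, and they are disjoint. -/
structure Cones (E : V → V → Prop) (K : Bool → V → Prop) : Prop where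
  closed : ∀ s x y, K s x → Rel s E x y → K s y
  disjoint : ∀ s x, K s x → ¬ K (!s) x

lemma Cones.ne {E : V → V → Prop} {K : Bool → V → Prop} (hK : Cones E K) {s : Bool} {x y : V}
    (hx : K s x) (hy : K (!s) y) : x ≠ y := by
  rintro rfl
  exact hK.disjoint s x hx hy

/-- No neighbour of the end `s` of the call lies strictly between the two ends. -/
def Clear (E : V → V → Prop) (s : Bool) (T : Order V n) (c : Call V) : Prop :=
  ∀ w, Rel s E (c.tip s) w → pos s T (c.tip !s) ≤ pos s T w

open Classical in
/-- One swap of the algorithm. -/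
structure Swaps (E : V → V → Prop) (K : Bool → V → Prop) (T : Order V n) (c : Call V)
    (T' : Order V n) : Prop where
  cone : ∀ s, K s (c.tip s)
  lt : T c.u < T c.v
  clear : ∀ s, Clear E s T c
  eq : T' = (Equiv.swap c.u c.v).trans T

/-- `T'` arises from `T` by one swap of the algorithm. -/
def Legal (E : V → V → Prop) (K : Bool → V → Prop) (T T' : Order V n) : Prop :=
  ∃ c, Swaps E K T c T'

variable {E : V → V → Prop} {K : Bool → V → Prop} {T T' : Order V n} {c : Call V}

lemma Swaps.apply_tip (h : Swaps E K T c T') (s : Bool) : T' (c.tip s) = T (c.tip !s) := by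
  rw [h.eq]
  cases s <;> simp [Call.tip]

lemma Swaps.apply_of_ne (h : Swaps E K T c T') {x : V} (hx : ∀ s, x ≠ c.tip s) : T' x = T x := by
  rw [h.eq]
  classical
  have h1 := hx true
  have h2 := hx false
  simp only [Call.tip] at h1 h2
  rw [Equiv.trans_apply, Equiv.swap_apply_of_ne_of_ne h1 h2]

/-- A neighbour in direction `s` of the end `s` stays in its cone, so it is not the other end; by
`Clear` it lies beyond the place to which the end moves. An edge of direction `s` at the other end
only gets longer, since that end moves backwards. -/
lemma Swaps.isTopOrder (hK : Cones E K) (h : Swaps E K T c T') (hT : IsTopOrder E T) :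
    IsTopOrder E T' := by
  have key : ∀ s x y, Rel s E x y → x = c.tip s → pos s T' x < pos s T' y := by
    rintro s x y hxy rfl
    have hy : K s y := hK.closed s _ _ (h.cone s) hxy
    have h1 : y ≠ c.tip !s := hK.ne hy (h.cone !s)
    have h2 : y ≠ c.tip s := by
      rintro rfl
      exact lt_irrefl _ (hT.pos_lt hxy)
    have h3 : T' y = T y := h.apply_of_ne (by
      intro r
      cases r <;> cases s <;> assumption)
    rw [pos_congr (h.apply_tip s), pos_congr h3]
    refine lt_of_le_of_ne (h.clear s y hxy) fun he => h1 (T.injective (eq_of_pos_eq he)).symm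
  have key2 : ∀ s x y, Rel s E x y → x = c.tip !s → pos s T' x < pos s T' y := by
    rintro s x y hxy rfl
    have h4 := (pos_tip_lt s).2 h.lt
    have h5 : pos s T' (c.tip !s) = pos s T (c.tip s) := by
      simpa using pos_congr (h.apply_tip !s)
    have h0 := hT.pos_lt hxy
    rw [h5]
    by_cases hy : y = c.tip s
    · rw [hy, pos_congr (h.apply_tip s)]
      exact h4
    · have h2 : y ≠ c.tip !s := by
        rintro rfl
        exact lt_irrefl _ h0
      have h3 : T' y = T y := h.apply_of_ne (by
        intro r
        cases r <;> cases s <;> assumption)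
      rw [pos_congr h3]
      exact h4.trans h0
  have key3 : ∀ s x y, Rel s E x y → (∃ r, x = c.tip r) → pos s T' x < pos s T' y := by
    rintro s x y hxy ⟨r, hr⟩
    by_cases hrs : r = s
    · subst hrs
      exact key r x y hxy hr
    · have : r = !s := by cases r <;> cases s <;> simp_all
      subst this
      exact key2 s x y hxy hr
  intro a b hab
  by_cases ha : ∃ r, a = c.tip r
  · exact pos_true_lt.1 (key3 true a b hab ha)
  by_cases hb : ∃ r, b = c.tip r
  · exact pos_false_lt.1 (key3 false b a hab hb)
  push Not at ha hb
  rw [h.apply_of_ne ha, h.apply_of_ne hb]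
  exact hT a b hab

lemma Swaps.pos_le (hK : Cones E K) (h : Swaps E K T c T') {s : Bool} {x : V} (hx : K s x) :
    pos s T x ≤ pos s T' x := by
  by_cases h1 : x = c.tip s
  · rw [h1, pos_congr (h.apply_tip s)]
    exact ((pos_tip_lt s).2 h.lt).le
  · have h2 : x ≠ c.tip !s := hK.ne hx (h.cone !s)
    rw [pos_congr (h.apply_of_ne (by
      intro r
      cases r <;> cases s <;> assumption))]

/-- `T'` arises from `T` by a sequence of swaps of the algorithm. -/
abbrev Reach (E : V → V → Prop) (K : Bool → V → Prop) : Order V n → Order V n → Prop :=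
  Relation.ReflTransGen (Legal E K)

lemma Reach.isTopOrder (hK : Cones E K) (h : Reach E K T T') (hT : IsTopOrder E T) :
    IsTopOrder E T' := by
  induction h with
  | refl => exact hT
  | tail _ h ih =>
    obtain ⟨c, hc⟩ := h
    exact hc.isTopOrder hK ih

lemma Reach.pos_le (hK : Cones E K) (h : Reach E K T T') {s : Bool} {x : V} (hx : K s x) :
    pos s T x ≤ pos s T' x := by
  induction h with
  | refl => exact le_rfl
  | tail _ h ih =>
    obtain ⟨c, hc⟩ := h
    exact ih.trans (hc.pos_le hK hx)

lemma Reach.pos_ge (hK : Cones E K) (h : Reach E K T T') {s : Bool} {x : V} (hx : K (!s) x) :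
    pos s T' x ≤ pos s T x := by
  have := Reach.pos_le hK h hx
  rw [pos_not, pos_not] at this
  omega

/-- `T'` differs from `T` only between the two ends of the call. -/
def Fixes (T : Order V n) (c : Call V) (T' : Order V n) : Prop :=
  ∀ s x, pos s T x < pos s T (c.tip s) → T' x = T x

lemma Fixes.le_pos (h : Fixes T c T') {s : Bool} {x : V} (hx : pos s T (c.tip s) ≤ pos s T x) :
    pos s T (c.tip s) ≤ pos s T' x := by
  by_contra! hlt
  -- `y` is the vertex that used to occupy the new place of `x`. It lies outside the range of the
  -- call, so it still occupies that place, which forces `y = x`.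
  set y := T.symm (T' x) with hy
  have hyx : T y = T' x := by simp [hy]
  have h1 : T' y = T y := h s y (by rwa [pos_congr hyx])
  have h2 : y = x := T'.injective (h1.trans hyx)
  rw [← h2, pos_congr h1, h2] at hlt
  omega

lemma Fixes.pos_le (h : Fixes T c T') {s : Bool} {x : V} (hx : pos s T x ≤ pos s T (c.tip !s)) :
    pos s T' x ≤ pos s T (c.tip !s) := by
  have := h.le_pos (s := !s) (x := x) (by rw [pos_not, pos_not]; omega)
  rw [pos_not, pos_not] at this
  omega

/-- What every execution of a call that leads from `T` to `T'` achieves. -/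
structure Basic (E : V → V → Prop) (K : Bool → V → Prop) (T : Order V n) (c : Call V)
    (T' : Order V n) : Prop where
  reach : Reach E K T T'
  fixes : Fixes T c T'
  sep : T' c.v < T' c.u

/-- What the algorithm guarantees when it makes a call. -/
structure Pre (E : V → V → Prop) (K : Bool → V → Prop) (T : Order V n) (c : Call V) : Prop where
  top : IsTopOrder E T
  cone : ∀ s, K s (c.tip s)
  clear : ∀ s, c.flag s = true → Clear E s T c

end Sides

/-! ### Sequential execution of lists of calls. -/

section Lists

variable {V : Type*} {n : ℕ}

/-- The calls of a list are executed one after the other, the execution of each one satisfying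
`P`. -/
def Steps (P : Order V n → Call V → Order V n → List (CallRecord V) → Prop) :
    Order V n → List (Call V) → Order V n → List (CallRecord V) → Prop
  | T, [], T', L => T' = T ∧ L = []
  | T, c :: cs, T', L => ∃ T₁ L₁ L₂, P T c T₁ L₁ ∧ Steps P T₁ cs T' L₂ ∧ L = L₁ ++ L₂

variable {P Q : Order V n → Call V → Order V n → List (CallRecord V) → Prop}

lemma steps_of_runCalls {exec : Order V n → Call V → Option (Outcome V n)} {cs : List (Call V)}
    {T T' : Order V n} {L : List (CallRecord V)} (h : runCalls exec T cs = some (T', L)) :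
    Steps (fun T c T' L => exec T c = some (T', L)) T cs T' L := by
  induction cs generalizing T L with
  | nil =>
    simp only [runCalls, Option.some.injEq, Prod.mk.injEq] at h
    exact ⟨h.1.symm, h.2.symm⟩
  | cons c cs ih =>
    simp only [runCalls, Option.bind_eq_some_iff, Option.map_eq_some_iff, Prod.mk.injEq] at h
    obtain ⟨⟨T₁, L₁⟩, h1, ⟨T₂, L₂⟩, h2, h3, h4⟩ := h
    simp only at h2 h3 h4
    subst h3
    exact ⟨T₁, L₁, L₂, h1, ih h2, h4.symm⟩

lemma Steps.append {l₁ l₂ : List (Call V)} {T T' : Order V n} {L : List (CallRecord V)}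
    (h : Steps P T (l₁ ++ l₂) T' L) :
    ∃ Tm L₁ L₂, Steps P T l₁ Tm L₁ ∧ Steps P Tm l₂ T' L₂ ∧ L = L₁ ++ L₂ := by
  induction l₁ generalizing T L with
  | nil => exact ⟨T, [], L, ⟨rfl, rfl⟩, h, rfl⟩
  | cons c cs ih =>
    obtain ⟨T₁, L₁, L₂, h1, h2, rfl⟩ := h
    obtain ⟨Tm, L₃, L₄, h3, h4, rfl⟩ := ih h2
    exact ⟨Tm, L₁ ++ L₃, L₄, ⟨T₁, L₁, L₃, h1, h3, rfl⟩, h4, by simp⟩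

lemma Steps.invariant {I : Order V n → Prop} {cs : List (Call V)} {T T' : Order V n}
    {L : List (CallRecord V)} (h : Steps P T cs T' L) (hT : I T)
    (hI : ∀ c ∈ cs, ∀ T T' L, I T → P T c T' L → I T') : I T' := by
  induction cs generalizing T L with
  | nil =>
    rw [h.1]
    exact hT
  | cons c cs ih =>
    obtain ⟨T₁, L₁, L₂, h1, h2, rfl⟩ := h
    exact ih h2 (hI c (by simp) _ _ _ hT h1) fun c' hc' => hI c' (by simp [hc'])

lemma Steps.refine_aux {cs : List (Call V)} (l : List (Call V)) {T₀ T T' : Order V n}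
    {L : List (CallRecord V)} {L₀ : List (CallRecord V)} (h₀ : Steps P T₀ l T L₀)
    (h : Steps P T cs T' L)
    (hPQ : ∀ l₁ c l₂, l ++ cs = l₁ ++ c :: l₂ → ∀ T₁ L₁ T₂ L₂, Steps P T₀ l₁ T₁ L₁ →
      P T₁ c T₂ L₂ → Q T₁ c T₂ L₂) : Steps Q T cs T' L := by
  induction cs generalizing T L l L₀ with
  | nil => exact h
  | cons c cs ih =>
    obtain ⟨T₁, L₁, L₂, h1, h2, rfl⟩ := h
    refine ⟨T₁, L₁, L₂, hPQ l c cs rfl _ _ _ _ h₀ h1,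
      ih (l := l ++ [c]) (L₀ := L₀ ++ L₁) ?_ h2 (by simpa using hPQ), rfl⟩
    clear hPQ h2 ih
    induction l generalizing T₀ L₀ with
    | nil =>
      obtain ⟨rfl, rfl⟩ := h₀
      exact ⟨T₁, L₁, [], h1, ⟨rfl, rfl⟩, by simp⟩
    | cons d ds ih =>
      obtain ⟨T₃, L₃, L₄, h3, h4, rfl⟩ := h₀
      exact ⟨T₃, L₃, L₄ ++ L₁, h3, ih h4, by simp⟩

/-- To refine what is known of each step, one may use all the steps before it. -/
lemma Steps.refine {cs : List (Call V)} {T T' : Order V n} {L : List (CallRecord V)}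
    (h : Steps P T cs T' L)
    (hPQ : ∀ l₁ c l₂, cs = l₁ ++ c :: l₂ → ∀ T₁ L₁ T₂ L₂, Steps P T l₁ T₁ L₁ →
      P T₁ c T₂ L₂ → Q T₁ c T₂ L₂) : Steps Q T cs T' L :=
  Steps.refine_aux [] (L₀ := []) ⟨rfl, rfl⟩ h hPQ

lemma Steps.mono {cs : List (Call V)} {T T' : Order V n} {L : List (CallRecord V)}
    (h : Steps P T cs T' L) (hPQ : ∀ T c T' L, P T c T' L → Q T c T' L) : Steps Q T cs T' L :=
  h.refine fun _ _ _ _ _ _ _ _ _ => hPQ _ _ _ _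

end Lists

/-! ### Structure of the two nested loops. -/

section Expansion

variable {V : Type*} {n : ℕ}

/-- The list `cs` of recursive calls made by a call `c` with the sets `S true` and `S false`. -/
structure Expansion (T : Order V n) (c : Call V) (S : Bool → Finset V) (cs : List (Call V)) :
    Prop where
  tip : ∀ c' ∈ cs, ∀ s, c'.tip s = c.tip s ∨ c'.tip s ∈ S s
  lt : ∀ c' ∈ cs, T c'.u < T c'.v
  flag : ∀ c' ∈ cs, ∀ s, c'.flag s = true ↔ c'.tip s = c.tip s ∧ S s = ∅
  last : ∃ l d, cs = l ++ [d] ∧ (∀ s, d.tip s = c.tip s) ∧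
    ∀ c' ∈ l, ∃ s, c'.tip s ≠ c.tip s
  before : ∀ l₁ c' l₂, cs = l₁ ++ c' :: l₂ → ∀ s, c'.tip s = c.tip s → ∀ w ∈ S s,
    pos s T w < pos s T (c'.tip !s) → ∃ d ∈ l₁, d.tip s = w ∧ d.tip (!s) = c'.tip !s

lemma mem_increasing (T : Order V n) (S : Finset V) (x : V) : x ∈ increasing T S ↔ x ∈ S := by
  classical
  simp only [increasing, List.mem_filter, List.mem_map, List.mem_finRange, true_and,
    decide_eq_true_eq, and_iff_right_iff_imp]
  exact fun _ => ⟨T x, by simp⟩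

lemma pairwise_increasing (T : Order V n) (S : Finset V) :
    (increasing T S).Pairwise fun a b => T a < T b := by
  classical
  refine List.Pairwise.filter _ ?_
  rw [List.pairwise_map]
  simpa using List.pairwise_lt_finRange n

lemma mem_recursiveCalls {T : Order V n} {u v : V} {A B : Finset V} {d : Call V} :
    d ∈ recursiveCalls T u v A B ↔ (d.u = u ∨ d.u ∈ A) ∧ (d.v = v ∨ d.v ∈ B) ∧ T d.u < T d.v ∧
      (d.f₁ = true ↔ d.u = u ∧ A = ∅) ∧ (d.f₂ = true ↔ d.v = v ∧ B = ∅) := by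
  classical
  simp only [recursiveCalls, List.mem_flatMap, List.mem_reverse, mem_increasing, List.mem_map,
    List.mem_filter, decide_eq_true_eq, Finset.mem_insert]
  constructor
  · rintro ⟨a, ha, b, ⟨hb, hab⟩, rfl⟩
    simp [ha, hb, hab]
  · rintro ⟨ha, hb, hab, h1, h2⟩
    refine ⟨d.u, ha, d.v, ⟨hb, hab⟩, ?_⟩
    obtain ⟨u', v', f, g⟩ := d
    simp only at h1 h2 ⊢
    congr 1
    · rw [Bool.eq_iff_iff]; simp [h1]
    · rw [Bool.eq_iff_iff]; simp [h2]

lemma pairwise_recursiveCalls (T : Order V n) (u v : V) (A B : Finset V) :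
    (recursiveCalls T u v A B).Pairwise fun a b =>
      T b.u < T a.u ∨ (a.u = b.u ∧ T a.v < T b.v) := by
  classical
  rw [recursiveCalls, List.pairwise_flatMap]
  constructor
  · intro a _
    rw [List.pairwise_map]
    refine List.Pairwise.imp ?_ (List.Pairwise.filter _ (pairwise_increasing T _))
    intro x y hxy
    exact Or.inr ⟨rfl, hxy⟩
  · rw [List.pairwise_reverse]
    refine (pairwise_increasing T _).imp ?_
    intro x y hxy a ha b hb
    simp only [List.mem_map] at ha hb
    obtain ⟨a', _, rfl⟩ := ha
    obtain ⟨b', _, rfl⟩ := hb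
    exact Or.inl hxy

lemma mem_left_of_pairwise {α : Type*} {r : α → α → Prop} {l l₁ l₂ : List α} {a b : α}
    (h : l.Pairwise r) (hl : l = l₁ ++ a :: l₂) (hb : b ∈ l) (hne : b ≠ a) (hr : ¬ r a b) :
    b ∈ l₁ := by
  subst hl
  rw [List.pairwise_append, List.pairwise_cons] at h
  simp only [List.mem_append, List.mem_cons] at hb
  rcases hb with hb | hb | hb
  · exact hb
  · exact absurd hb hne
  · exact absurd (h.2.1.1 b hb) hr

/-- The calls are ordered lexicographically, by decreasing `u'` and then by increasing `v'`. Hence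
`(u, v)` comes last, `(w, v')` precedes `(u, v')` for `w` in `A`, and `(u', w)` precedes `(u', v)`
for `w` in `B`. -/
lemma expansion_recursiveCalls {T : Order V n} {c : Call V} {S : Bool → Finset V}
    (hc : T c.u < T c.v) (hA : ∀ w ∈ S true, T c.u < T w)
    (hB : ∀ w ∈ S false, T w < T c.v) :
    Expansion T c S (recursiveCalls T c.u c.v (S true) (S false)) := by
  classical
  have hp := pairwise_recursiveCalls T c.u c.v (S true) (S false)
  refine ⟨?_, ?_, ?_, ?_, ?_⟩
  · intro c' hc' s
    have h := mem_recursiveCalls.1 hc'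
    cases s
    · exact h.2.1
    · exact h.1
  · intro c' hc'
    exact (mem_recursiveCalls.1 hc').2.2.1
  · intro c' hc' s
    have h := mem_recursiveCalls.1 hc'
    cases s
    · exact h.2.2.2.2
    · exact h.2.2.2.1
  · set d : Call V := ⟨c.u, c.v, decide (S true = ∅), decide (S false = ∅)⟩ with hd
    have hmem : d ∈ recursiveCalls T c.u c.v (S true) (S false) :=
      mem_recursiveCalls.2 (by simp [hd, hc])
    obtain ⟨l, l₂, hl⟩ := List.append_of_mem hmem
    have hsub := fun x (hx : x ∈ recursiveCalls T c.u c.v (S true) (S false)) =>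
      mem_recursiveCalls.1 hx
    rw [hl] at hp hsub
    rw [List.pairwise_append, List.pairwise_cons] at hp
    have hge : ∀ x ∈ l ++ d :: l₂, T c.u ≤ T x.u ∧ T x.v ≤ T c.v := by
      intro x hx
      obtain ⟨h1, h2, -⟩ := hsub x hx
      constructor
      · rcases h1 with h1 | h1
        · rw [h1]
        · exact (hA _ h1).le
      · rcases h2 with h2 | h2
        · rw [h2]
        · exact (hB _ h2).le
    have hl₂ : l₂ = [] := by
      rw [List.eq_nil_iff_forall_not_mem]
      intro x hx
      have h1 := hge x (by simp [hx])
      rcases hp.2.1.1 x hx with h2 | h2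
      · exact absurd h2 (not_lt.2 h1.1)
      · exact absurd h2.2 (not_lt.2 h1.2)
    refine ⟨l, d, by rw [hl, hl₂], fun s => by cases s <;> rfl, ?_⟩
    intro x hx
    rcases hp.2.2 x hx d (by simp) with h2 | h2
    · exact ⟨true, fun h => by simp only [Call.tip] at h; rw [h] at h2; exact lt_irrefl _ h2⟩
    · exact ⟨false, fun h => by simp only [Call.tip] at h; rw [h] at h2; exact lt_irrefl _ h2.2⟩
  · intro l₁ c' l₂ hl s hs w hw hlt
    have hc' := mem_recursiveCalls.1 (hl ▸ (by simp : c' ∈ l₁ ++ c' :: l₂))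
    cases s
    · simp only [Call.tip, Bool.not_false] at hs hlt ⊢
      rw [pos_false_lt] at hlt
      set d : Call V := ⟨c'.u, w, c'.f₁, decide (w = c.v ∧ S false = ∅)⟩ with hd
      have hmem : d ∈ recursiveCalls T c.u c.v (S true) (S false) :=
        mem_recursiveCalls.2 (by simp [hd, hw, hc', hlt])
      have hwv : T w < T c'.v := hs ▸ hB w hw
      refine ⟨d, mem_left_of_pairwise hp hl hmem ?_ ?_, rfl, rfl⟩
      · intro h
        rw [← h] at hwv
        exact lt_irrefl _ hwv
      · simp [hd, hwv.le]
    · simp only [Call.tip, Bool.not_true] at hs hlt ⊢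
      rw [pos_true_lt] at hlt
      set d : Call V := ⟨w, c'.v, decide (w = c.u ∧ S true = ∅), c'.f₂⟩ with hd
      have hmem : d ∈ recursiveCalls T c.u c.v (S true) (S false) :=
        mem_recursiveCalls.2 (by simp [hd, hw, hc', hlt])
      have hwu : T c'.u < T w := hs ▸ hA w hw
      refine ⟨d, mem_left_of_pairwise hp hl hmem ?_ ?_, rfl, rfl⟩
      · intro h
        rw [← h] at hwu
        exact lt_irrefl _ hwu
      · have : c'.u ≠ w := by
          rintro h
          rw [h] at hwu
          exact lt_irrefl _ hwu
        simp [hd, hwu.le, this]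

end Expansion

end OnlineTopSort

namespace OnlineTopSort

/-! ### The sets chosen by a call, and one unfolding of the procedure. -/

section Selection

variable {V : Type*} {n : ℕ}

/-- The distance of the two ends of a call with `u < v`, in the order `T`. -/
def Call.len (c : Call V) (T : Order V n) : ℝ := ((pos true T c.v - pos true T c.u : ℤ) : ℝ)

lemma Call.len_eq (c : Call V) (T : Order V n) (s : Bool) :
    c.len T = ((pos s T (c.tip !s) - pos s T (c.tip s) : ℤ) : ℝ) := by
  cases s
  · simp [Call.len, pos, Call.tip]
    ring
  · rfl

/-- The sets `S true = A` and `S false = B` that a call selects, with the sets `I true` and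
`I false` of computed indices. -/
structure Selection (E : V → V → Prop) (t : ℕ → ℝ) (p : ℕ) (T : Order V n) (c : Call V)
    (S : Bool → Finset V) (I : Bool → Finset ℕ) : Prop where
  sub : ∀ s, ∀ w ∈ S s, Rel s E (c.tip s) w ∧ pos s T w < pos s T (c.tip !s)
  clear : ∀ s, (c.flag s = true → Clear E s T c) → S s = ∅ → Clear E s T c
  flag : ∀ s i, i ∈ I s → i + 1 ∈ I s → c.flag s = false
  len : ∀ s i, i ∈ I s → i + 1 ∈ I s → t i < c.len T ∧ c.len T ≤ t (i + 1)
  full : ∀ s i, i ∈ I s → i + 1 ∈ I s → ∀ w, Rel s E (c.tip s) w →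
    pos s T w < pos s T (c.tip !s) → w ∈ S s
  far : ∀ s i, i ∈ I s → i + 1 ∈ I s → ∀ w ∈ S s,
    t i < ((pos s T w - pos s T (c.tip s) : ℤ) : ℝ)

/-- `Â_j` for `true` and `B̂_j` for `false`. -/
noncomputable def hat [Fintype V] (E : V → V → Prop) (t : ℕ → ℝ) (T : Order V n) (c : Call V) :
    Bool → ℕ → Finset V
  | true => hatA E t T c.u c.v
  | false => hatB E t T c.u c.v

lemma mem_hat [Fintype V] {E : V → V → Prop} {t : ℕ → ℝ} {T : Order V n} {c : Call V} (hT : IsTopOrder E T)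
    {s : Bool} {j : ℕ} {w : V} : w ∈ hat E t T c s j ↔ Rel s E (c.tip s) w ∧
      ((pos s T w - pos s T (c.tip s) : ℤ) : ℝ) ≤ t j ∧ pos s T w < pos s T (c.tip !s) := by
  cases s
  · simp only [hat, hatB, Finset.mem_filter, Finset.mem_univ, true_and, Rel, Bool.not_false,
      pos_false_lt]
    refine and_congr_right fun h => and_congr ?_ Iff.rfl
    have h1 : ((T w : ℕ) : ℝ) < (T c.v : ℕ) := by exact_mod_cast hT _ _ h
    rw [posDist, abs_of_pos (sub_pos.2 h1)]
    simp only [pos, Call.tip]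
    push_cast
    rw [show -((T w : ℕ) : ℝ) - -((T c.v : ℕ) : ℝ) = (T c.v : ℕ) - (T w : ℕ) by ring]
  · simp only [hat, hatA, Finset.mem_filter, Finset.mem_univ, true_and, Rel, Bool.not_true,
      pos_true_lt]
    refine and_congr_right fun h => and_congr ?_ Iff.rfl
    have h1 : ((T c.u : ℕ) : ℝ) < (T w : ℕ) := by exact_mod_cast hT _ _ h
    rw [posDist, abs_of_pos (sub_pos.2 h1)]
    simp [pos, Call.tip]

lemma level_eq_some {p : ℕ} {t : ℕ → ℝ} {d : ℝ} {i : ℕ} (h : level p t d = some i) :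
    t i < d ∧ d ≤ t (i + 1) := by
  classical
  simpa using List.find?_some h

lemma level_eq_none {p : ℕ} {t : ℕ → ℝ} {d : ℝ} (hd : d ≤ t (p + 1)) (h : level p t d = none) :
    d ≤ t 0 := by
  classical
  have h' : ∀ i < p + 1, t i < d → t (i + 1) < d := by
    simpa [level] using h
  by_contra! h0
  have : ∀ i ≤ p + 1, t i < d := by
    intro i
    induction i with
    | zero => exact fun _ => h0
    | succ i ih => exact fun hi => h' i (by omega) (ih (by omega))
  exact absurd hd (not_le.2 (this _ le_rfl))

/-- Once the radius is at least the distance of the ends, the set contains every neighbour between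
them, so its emptiness means `Clear`. A smaller radius can give the empty set only if the flag is
set, and then `Clear` is inherited. Two indices are computed only in the unflagged case with an
empty inner set, which makes all selected vertices far. -/
lemma selection_select [Fintype V] {E : V → V → Prop} {t : ℕ → ℝ} {p : ℕ} {T : Order V n} {c : Call V}
    (hT : IsTopOrder E T) (hd : c.len T ≤ t (p + 1)) :
    Selection E t p T c (fun s => (select (level p t (c.len T)) (c.flag s) (hat E t T c s)).1)
      (fun s => (select (level p t (c.len T)) (c.flag s) (hat E t T c s)).2) := by
  have hclear : ∀ s j, c.len T ≤ t j → hat E t T c s j = ∅ → Clear E s T c := by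
    intro s j hj h0 w hw
    by_contra! hlt
    have : w ∈ hat E t T c s j := by
      refine (mem_hat hT).2 ⟨hw, le_trans ?_ hj, hlt⟩
      rw [c.len_eq T s]
      exact_mod_cast (by omega)
    rw [h0] at this
    simp at this
  have hsub : ∀ s j, ∀ w ∈ hat E t T c s j,
      Rel s E (c.tip s) w ∧ pos s T w < pos s T (c.tip !s) := fun s j w hw =>
    ⟨((mem_hat hT).1 hw).1, ((mem_hat hT).1 hw).2.2⟩
  have hnone : ∀ i, i ∈ ({0} : Finset ℕ) → i + 1 ∈ ({0} : Finset ℕ) → False := by simp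
  have hsome : ∀ i j, i ∈ ({j} : Finset ℕ) → i + 1 ∈ ({j} : Finset ℕ) → False := by
    intro i j h1 h2
    simp only [Finset.mem_singleton] at h1 h2
    omega
  have hboth : ∀ i j, i ∈ ({j, j + 1} : Finset ℕ) → i + 1 ∈ ({j, j + 1} : Finset ℕ) → i = j := by
    intro i j h1 h2
    simp only [Finset.mem_singleton, Finset.mem_insert] at h1 h2
    omega
  cases hl : level p t (c.len T) with
  | none =>
    have h0 := level_eq_none hd hl
    exact ⟨fun s => hsub s 0, fun s _ => hclear s 0 h0, fun s i h1 h2 => (hnone i h1 h2).elim,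
      fun s i h1 h2 => (hnone i h1 h2).elim, fun s i h1 h2 => (hnone i h1 h2).elim,
      fun s i h1 h2 => (hnone i h1 h2).elim⟩
  | some j =>
    have hj := level_eq_some hl
    have key : ∀ s, (select (some j) (c.flag s) (hat E t T c s) = (hat E t T c s j, {j}) ∧
          (hat E t T c s j ≠ ∅ ∨ c.flag s = true)) ∨
        (select (some j) (c.flag s) (hat E t T c s) = (hat E t T c s (j + 1), {j, j + 1}) ∧
          hat E t T c s j = ∅ ∧ c.flag s = false) := by
      intro s
      by_cases h : hat E t T c s j ≠ ∅ ∨ c.flag s = true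
      · exact Or.inl ⟨by simp only [select, if_pos h], h⟩
      · refine Or.inr ⟨by simp only [select, if_neg h], ?_⟩
        simpa using h
    have key2 : ∀ s i, i ∈ (select (some j) (c.flag s) (hat E t T c s)).2 →
        i + 1 ∈ (select (some j) (c.flag s) (hat E t T c s)).2 → i = j ∧
        (select (some j) (c.flag s) (hat E t T c s)).1 = hat E t T c s (j + 1) ∧
          hat E t T c s j = ∅ ∧ c.flag s = false := by
      intro s i h1 h2
      rcases key s with ⟨h, -⟩ | ⟨h, h'⟩
      · rw [h] at h1 h2
        exact (hsome _ _ h1 h2).elim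
      · rw [h] at h1 h2
        exact ⟨hboth _ _ h1 h2, by rw [h], h'⟩
    refine ⟨?_, ?_, ?_, ?_, ?_, ?_⟩
    · intro s
      rcases key s with ⟨h, -⟩ | ⟨h, -⟩ <;> rw [h] <;> exact hsub s _
    · intro s hf h0
      rcases key s with ⟨h, h'⟩ | ⟨h, -⟩ <;> rw [h] at h0
      · exact hf (h'.resolve_left fun h => h h0)
      · exact hclear s _ hj.2 h0
    · intro s i h1 h2
      exact (key2 s i h1 h2).2.2.2
    · intro s i h1 h2
      rw [(key2 s i h1 h2).1]
      exact hj
    · intro s i h1 h2 w hw hlt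
      rw [(key2 s i h1 h2).2.1, mem_hat hT]
      refine ⟨hw, le_trans ?_ hj.2, hlt⟩
      rw [c.len_eq T s]
      exact_mod_cast (by omega)
    · intro s i h1 h2 w hw
      obtain ⟨hij, hS, h0, -⟩ := key2 s i h1 h2
      rw [hS, mem_hat hT] at hw
      by_contra! hle
      have : w ∈ hat E t T c s j := (mem_hat hT).2 ⟨hw.1, hij ▸ hle, hw.2.2⟩
      rw [h0] at this
      simp at this

lemma Selection.expansion {E : V → V → Prop} {t : ℕ → ℝ} {p : ℕ} {T : Order V n} {c : Call V}
    {S : Bool → Finset V} {I : Bool → Finset ℕ} (h : Selection E t p T c S I)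
    (hT : IsTopOrder E T) (hc : T c.u < T c.v) :
    Expansion T c S (recursiveCalls T c.u c.v (S true) (S false)) :=
  expansion_recursiveCalls hc (fun w hw => hT _ _ (h.sub true w hw).1)
    (fun w hw => hT _ _ (h.sub false w hw).1)

lemma reorder_exit [Fintype V] {E : V → V → Prop} {t : ℕ → ℝ} {p : ℕ} {T : Order V n} {c : Call V}
    (hc : T c.v ≤ T c.u) (depth : ℕ) :
    reorder E p t (depth + 1) T c =
      some (T, [{ call := c, computedA := ∅, computedB := ∅ }]) := by
  simp [reorder, hc]

open Classical in
/-- The execution of a call that is not left at once. -/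
lemma reorder_succ [Fintype V] {E : V → V → Prop} {t : ℕ → ℝ} {p : ℕ} {T : Order V n} {c : Call V}
    (hT : IsTopOrder E T) (hp : t (p + 1) = n) (hc : T c.u < T c.v) :
    ∃ (S : Bool → Finset V) (I : Bool → Finset ℕ), Selection E t p T c S I ∧
      ((∀ s, S s = ∅) → ∀ depth, reorder E p t (depth + 1) T c =
        some ((Equiv.swap c.u c.v).trans T, [⟨c, I true, I false⟩])) ∧
      ((∃ s, S s ≠ ∅) → ∃ cs, Expansion T c S cs ∧ ∀ depth, reorder E p t (depth + 1) T c =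
        (runCalls (reorder E p t depth) T cs).map fun r =>
          (r.1, (⟨c, I true, I false⟩ : CallRecord V) :: r.2)) := by
  have hlen : posDist T c.u c.v = c.len T := by
    have h1 : ((T c.u : ℕ) : ℝ) < (T c.v : ℕ) := by exact_mod_cast hc
    rw [posDist, abs_of_pos (sub_pos.2 h1)]
    simp [Call.len, pos]
  have hd : c.len T ≤ t (p + 1) := by
    have h1 : ((T c.v : ℕ) : ℝ) < n := by exact_mod_cast (T c.v).2
    have h2 : (0 : ℝ) ≤ (T c.u : ℕ) := by positivity
    rw [hp]
    simp only [Call.len, pos]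
    push_cast
    linarith
  have hsel := selection_select hT hd
  refine ⟨_, _, hsel, fun h depth => ?_, fun h => ⟨_, hsel.expansion hT hc, fun depth => ?_⟩⟩
  · have h1 := h true
    have h2 := h false
    rw [← hlen] at h1 h2
    simp only [Call.flag, hat] at h1 h2
    simp only [reorder, not_le.2 hc, if_false, ← hlen, Call.flag, hat, h1, h2, and_self, if_true]
  · have h1 : ¬ ((select (level p t (posDist T c.u c.v)) c.f₁ (hatA E t T c.u c.v)).1 = ∅ ∧
        (select (level p t (posDist T c.u c.v)) c.f₂ (hatB E t T c.u c.v)).1 = ∅) := by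
      obtain ⟨s, hs⟩ := h
      rw [← hlen] at hs
      cases s <;> simp only [Call.flag, hat] at hs
      · exact fun h => hs h.2
      · exact fun h => hs h.1
    simp only [reorder, not_le.2 hc, if_false, ← hlen, Call.flag, hat, if_neg h1]

end Selection

end OnlineTopSort

namespace OnlineTopSort

/-! ### Invariants of an execution: legal swaps, locality, separation of the ends. -/

section Correctness

variable {V : Type*} {n : ℕ} {E : V → V → Prop} {K : Bool → V → Prop} {t : ℕ → ℝ} {p : ℕ}
  {T T₁ T' : Order V n} {c c' : Call V} {S : Bool → Finset V} {I : Bool → Finset ℕ}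
  {cs : List (Call V)}

lemma Basic.transGen (h : Basic E K T c T') (hc : T c.u < T c.v) :
    Relation.TransGen (Legal E K) T T' := by
  rcases Relation.reflTransGen_iff_eq_or_transGen.1 h.reach with h1 | h1
  · have := h.sep
    rw [h1] at this
    exact absurd hc this.not_gt
  · exact h1

lemma Expansion.tip_ge (hT : IsTopOrder E T) (hS : Selection E t p T c S I)
    (hE : Expansion T c S cs) (h : c' ∈ cs) (s : Bool) :
    pos s T (c.tip s) ≤ pos s T (c'.tip s) := by
  rcases hE.tip c' h s with h1 | h1
  · rw [h1]
  · exact (hT.pos_lt (hS.sub s _ h1).1).le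

lemma Expansion.tip_le (hc : T c.u < T c.v) (hS : Selection E t p T c S I)
    (hE : Expansion T c S cs) (h : c' ∈ cs) (s : Bool) :
    pos s T (c'.tip s) ≤ pos s T (c.tip !s) := by
  rcases hE.tip c' h s with h1 | h1
  · rw [h1]
    exact ((pos_tip_lt s).2 hc).le
  · exact (hS.sub s _ h1).2.le

/-- The situation while the recursive calls `cs` of the call `c` on the order `T` are executed. -/
structure Node (E : V → V → Prop) (K : Bool → V → Prop) (t : ℕ → ℝ) (p : ℕ) (T : Order V n)
    (c : Call V) (S : Bool → Finset V) (I : Bool → Finset ℕ) (cs : List (Call V)) : Prop where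
  cones : Cones E K
  pre : Pre E K T c
  lt : T c.u < T c.v
  sel : Selection E t p T c S I
  exp : Expansion T c S cs

namespace Node

lemma tip_ge (h : Node E K t p T c S I cs) (hf : Fixes T c T₁) (hc' : c' ∈ cs) (s : Bool) :
    pos s T (c.tip s) ≤ pos s T₁ (c'.tip s) :=
  hf.le_pos (h.exp.tip_ge h.pre.top h.sel hc' s)

lemma tip_le (h : Node E K t p T c S I cs) (hf : Fixes T c T₁) (hc' : c' ∈ cs) (s : Bool) :
    pos s T₁ (c'.tip !s) ≤ pos s T (c.tip !s) := by
  have := h.tip_ge hf hc' !s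
  rw [pos_not, pos_not] at this
  omega

lemma cone (h : Node E K t p T c S I cs) (hc' : c' ∈ cs) (s : Bool) : K s (c'.tip s) := by
  rcases h.exp.tip c' hc' s with h1 | h1
  · rw [h1]
    exact h.pre.cone s
  · exact h.cones.closed s _ _ (h.pre.cone s) (h.sel.sub s _ h1).1

/-- A neighbour of the end `s` of `c` that is found between the ends of a recursive call
was between the ends of `c`. -/
lemma lt_of_lt (h : Node E K t p T c S I cs) (hf : Fixes T c T₁) (hc' : c' ∈ cs) {s : Bool} {w : V}
    (hw : Rel s E (c.tip s) w) (hlt : pos s T₁ w < pos s T₁ (c'.tip !s)) :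
    pos s T w < pos s T (c.tip !s) := by
  by_contra! hge
  have hne : w ≠ c.tip !s :=
    h.cones.ne (h.cones.closed s _ _ (h.pre.cone s) hw) (h.pre.cone !s)
  have hgt : pos s T (c.tip !s) < pos s T w :=
    lt_of_le_of_ne hge fun he => hne (T.injective (eq_of_pos_eq he)).symm
  have h1 : T₁ w = T w := hf (!s) w (by rw [pos_not, pos_not]; omega)
  have h2 := h.tip_le hf hc' s
  rw [pos_congr h1] at hlt
  omega

/-- A flag passed on means that the selected set was empty, hence that the end was clear at the
start of `c`. It remains clear because vertices beyond the ends of `c` do not move. -/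
lemma pre_child (h : Node E K t p T c S I cs) (hr : Reach E K T T₁) (hf : Fixes T c T₁)
    (hc' : c' ∈ cs) : Pre E K T₁ c' := by
  refine ⟨hr.isTopOrder h.cones h.pre.top, h.cone hc', fun s hs w hw => ?_⟩
  obtain ⟨h1, h2⟩ := (h.exp.flag c' hc' s).1 hs
  by_contra! hlt
  rw [h1] at hw
  have h3 := h.lt_of_lt hf hc' hw hlt
  have h4 := h.sel.clear s (h.pre.clear s) h2 w hw
  omega

lemma fixes_trans (h : Node E K t p T c S I cs) (hf : Fixes T c T₁) (hc' : c' ∈ cs)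
    (hf' : Fixes T₁ c' T') : Fixes T c T' := by
  intro s x hx
  have h1 := hf s x hx
  rw [← h1]
  refine hf' s x (lt_of_lt_of_le ?_ (h.tip_ge hf hc' s))
  rwa [pos_congr h1]

variable {P : Order V n → Call V → Order V n → List (CallRecord V) → Prop}

lemma within (h : Node E K t p T c S I cs)
    (hP : ∀ T c T' L, P T c T' L → Pre E K T c → Basic E K T c T')
    {l : List (Call V)} (hl : l ⊆ cs) {L : List (CallRecord V)} (hs : Steps P T l T₁ L) :
    Reach E K T T₁ ∧ Fixes T c T₁ := by
  refine hs.invariant (I := fun T₁ => Reach E K T T₁ ∧ Fixes T c T₁)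
    ⟨.refl, fun _ _ _ => rfl⟩ ?_
  rintro c' hc' T₂ T₃ L' ⟨hr, hf⟩ h1
  have hb := hP _ _ _ _ h1 (h.pre_child hr hf (hl hc'))
  exact ⟨hr.trans hb.reach, h.fixes_trans hf (hl hc') hb.fixes⟩

/-- The separation of the ends of `c` comes from the last recursive call, which has the same ends.
-/
lemma basic (h : Node E K t p T c S I cs)
    (hP : ∀ T c T' L, P T c T' L → Pre E K T c → Basic E K T c T')
    {L : List (CallRecord V)} (hs : Steps P T cs T' L) : Basic E K T c T' := by
  obtain ⟨hr, hf⟩ := h.within hP (List.Subset.refl _) hs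
  obtain ⟨l, d, rfl, hd, -⟩ := h.exp.last
  obtain ⟨T₂, L₁, L₂, h1, h2, rfl⟩ := hs.append
  obtain ⟨T₃, L₃, L₄, h3, ⟨rfl, rfl⟩, rfl⟩ := h2
  obtain ⟨hr', hf'⟩ := h.within hP (by simp) h1
  have hb := hP _ _ _ _ h3 (h.pre_child hr' hf' (by simp))
  refine ⟨hr, hf, ?_⟩
  have := hb.sep
  rwa [show d.u = c.u from hd true, show d.v = c.v from hd false] at this

end Node

lemma Pre.basic_exit (hK : Cones E K) (h : Pre E K T c) (hc : T c.v ≤ T c.u) :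
    Basic E K T c T := by
  refine ⟨.refl, fun _ _ _ => rfl, lt_of_le_of_ne hc fun he => ?_⟩
  exact hK.ne (h.cone true) (h.cone false) (T.injective he).symm

lemma Swaps.basic (h : Swaps E K T c T') : Basic E K T c T' := by
  refine ⟨.single ⟨c, h⟩, fun s x hx => h.apply_of_ne ?_, ?_⟩
  · intro r hr
    have h1 := (pos_tip_lt s).2 h.lt
    have : r = s ∨ r = !s := by cases r <;> cases s <;> simp
    rcases this with rfl | rfl <;> rw [hr] at hx <;> omega
  · have h1 : T' c.u = T c.v := h.apply_tip true
    have h2 : T' c.v = T c.u := h.apply_tip false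
    rw [h1, h2]
    exact h.lt

/-- The possible executions of a call. -/
lemma reorder_cases [Fintype V] (hK : Cones E K) (hp : t (p + 1) = n) {depth : ℕ}
    {L : List (CallRecord V)} (h : reorder E p t depth T c = some (T', L)) (hpre : Pre E K T c) :
    (T c.v ≤ T c.u ∧ T' = T ∧ L = [⟨c, ∅, ∅⟩]) ∨
    ∃ S I, T c.u < T c.v ∧ Selection E t p T c S I ∧
      ((Swaps E K T c T' ∧ (∀ s, S s = ∅) ∧ L = [⟨c, I true, I false⟩]) ∨
      ∃ d cs L', depth = d + 1 ∧ Node E K t p T c S I cs ∧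
        Steps (fun T c T' L => reorder E p t d T c = some (T', L)) T cs T' L' ∧
        L = ⟨c, I true, I false⟩ :: L') := by
  cases depth with
  | zero => simp [reorder] at h
  | succ d =>
    rcases le_or_gt (T c.v) (T c.u) with hc | hc
    · rw [reorder_exit hc] at h
      simp only [Option.some.injEq, Prod.mk.injEq] at h
      exact Or.inl ⟨hc, h.1.symm, h.2.symm⟩
    · obtain ⟨S, I, hS, h1, h2⟩ := reorder_succ hpre.top hp hc
      refine Or.inr ⟨S, I, hc, hS, ?_⟩
      by_cases h0 : ∀ s, S s = ∅
      · rw [h1 h0] at h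
        simp only [Option.some.injEq, Prod.mk.injEq] at h
        exact Or.inl ⟨⟨hpre.cone, hc, fun s => hS.clear s (hpre.clear s) (h0 s), h.1.symm⟩, h0,
          h.2.symm⟩
      · push Not at h0
        obtain ⟨cs, hcs, h3⟩ := h2 (by simpa [Finset.nonempty_iff_ne_empty] using h0)
        rw [h3] at h
        simp only [Option.map_eq_some_iff, Prod.mk.injEq] at h
        obtain ⟨⟨T₁, L'⟩, h4, rfl, rfl⟩ := h
        exact Or.inr ⟨d, cs, L', rfl, ⟨hK, hpre, hc, hS, hcs⟩, steps_of_runCalls h4, rfl⟩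

theorem reorder_basic [Fintype V] (hK : Cones E K) (hp : t (p + 1) = n) {depth : ℕ}
    {L : List (CallRecord V)} (h : reorder E p t depth T c = some (T', L)) (hpre : Pre E K T c) :
    Basic E K T c T' := by
  induction depth generalizing T c T' L with
  | zero => simp [reorder] at h
  | succ depth ih =>
    rcases reorder_cases hK hp h hpre with
      ⟨hc, rfl, -⟩ | ⟨S, I, hc, hS, ⟨hsw, -⟩ | ⟨d, cs, L', hd, hN, hs, -⟩⟩
    · exact hpre.basic_exit hK hc
    · exact hsw.basic
    · obtain rfl : depth = d := by omega
      exact hN.basic (fun _ _ _ _ h1 h2 => ih h1 h2) hs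

end Correctness

end OnlineTopSort

namespace OnlineTopSort

/-! ### Termination. -/

section Termination

variable {V : Type*} [Fintype V] {n : ℕ} {E : V → V → Prop} {K : Bool → V → Prop} {t : ℕ → ℝ}
  {p : ℕ}

lemma runCalls_cons_terminates {c : Call V} {cs : List (Call V)} {T : Order V n}
    (hc : ∃ N, ∀ depth, N ≤ depth → ∃ T' L, reorder E p t depth T c = some (T', L))
    (hcs : ∀ T₁ depth L, reorder E p t depth T c = some (T₁, L) → ∃ N, ∀ depth, N ≤ depth →
      ∃ T' L, runCalls (reorder E p t depth) T₁ cs = some (T', L)) :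
    ∃ N, ∀ depth, N ≤ depth →
      ∃ T' L, runCalls (reorder E p t depth) T (c :: cs) = some (T', L) := by
  classical
  obtain ⟨N, hN⟩ := hc
  -- The order after the first call might formally vary with `depth`. A bound is therefore chosen
  -- for every order, and the supremum is taken over the finitely many orders.
  have key : ∀ T', ∃ N', ∀ d L, reorder E p t d T c = some (T', L) → ∀ depth, N' ≤ depth →
      ∃ T'' L, runCalls (reorder E p t depth) T' cs = some (T'', L) := by
    intro T'
    by_cases h : ∃ d L, reorder E p t d T c = some (T', L)
    · obtain ⟨d, L, h⟩ := h
      obtain ⟨N', hN'⟩ := hcs T' d L h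
      exact ⟨N', fun _ _ _ => hN'⟩
    · exact ⟨0, fun d L h' => absurd ⟨d, L, h'⟩ h⟩
  choose N' hN' using key
  refine ⟨max N (Finset.univ.sup N'), fun depth hd => ?_⟩
  obtain ⟨T₁, L₁, h1⟩ := hN depth (le_trans (le_max_left _ _) hd)
  obtain ⟨T₂, L₂, h2⟩ := hN' T₁ depth L₁ h1 depth
    ((Finset.le_sup (Finset.mem_univ T₁)).trans ((le_max_right _ _).trans hd))
  exact ⟨T₂, L₁ ++ L₂, by simp [runCalls, h1, h2]⟩

lemma runCalls_terminates {I : Order V n → Prop} {cs : List (Call V)} {T : Order V n} (hT : I T)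
    (hI : ∀ c ∈ cs, ∀ T depth T' L, I T → reorder E p t depth T c = some (T', L) → I T')
    (ht : ∀ c ∈ cs, ∀ T, I T → ∃ N, ∀ depth, N ≤ depth →
      ∃ T' L, reorder E p t depth T c = some (T', L)) :
    ∃ N, ∀ depth, N ≤ depth →
      ∃ T' L, runCalls (reorder E p t depth) T cs = some (T', L) := by
  induction cs generalizing T with
  | nil => exact ⟨0, fun _ _ => ⟨T, [], rfl⟩⟩
  | cons c cs ih =>
    refine runCalls_cons_terminates (ht c (by simp) T hT) fun T₁ d L h => ?_
    exact ih (hI c (by simp) _ _ _ _ hT h) (fun c' hc' => hI c' (by simp [hc']))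
      (fun c' hc' => ht c' (by simp [hc']))

omit [Fintype V] in
lemma Reach.le_of_legal {Φ : Order V n → ℕ} (hΦ : ∀ T T', Legal E K T T' → Φ T < Φ T')
    {T T' : Order V n} (h : Reach E K T T') : Φ T ≤ Φ T' := by
  induction h with
  | refl => exact le_rfl
  | tail _ h ih => exact ih.trans (hΦ _ _ h).le

omit [Fintype V] in
lemma lt_of_transGen_legal {Φ : Order V n → ℕ} (hΦ : ∀ T T', Legal E K T T' → Φ T < Φ T')
    {T T' : Order V n} (h : Relation.TransGen (Legal E K) T T') : Φ T < Φ T' := by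
  induction h with
  | single h => exact hΦ _ _ h
  | tail _ h ih => exact ih.trans (hΦ _ _ h)

/-- Induction on the remaining potential, then on the distance of the ends. The factor `n + 1` makes
any gain of potential outweigh every possible distance. -/
theorem reorder_terminates (hK : Cones E K) (hp : t (p + 1) = n) {Φ : Order V n → ℕ} {B : ℕ}
    (hΦ : ∀ T T', Legal E K T T' → Φ T < Φ T') (hB : ∀ T, Φ T ≤ B) (T : Order V n) (c : Call V)
    (hpre : Pre E K T c) :
    ∃ N, ∀ depth, N ≤ depth → ∃ T' L, reorder E p t depth T c = some (T', L) := by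
  induction hm : (B - Φ T) * (n + 1) + ((T c.v : ℕ) - (T c.u : ℕ)) using Nat.strong_induction_on
    generalizing T c with
  | _ m ih =>
  rcases le_or_gt (T c.v) (T c.u) with hc | hc
  · refine ⟨1, fun depth hd => ?_⟩
    obtain ⟨d, rfl⟩ := Nat.exists_eq_add_of_le' hd
    exact ⟨_, _, reorder_exit hc d⟩
  obtain ⟨S, I, hS, h1, h2⟩ := reorder_succ hpre.top hp hc
  by_cases h0 : ∀ s, S s = ∅
  · refine ⟨1, fun depth hd => ?_⟩
    obtain ⟨d, rfl⟩ := Nat.exists_eq_add_of_le' hd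
    exact ⟨_, _, h1 h0 d⟩
  obtain ⟨cs, hcs, h3⟩ := h2 (not_forall.1 h0)
  rw [not_forall] at h0
  have hN : Node E K t p T c S I cs := ⟨hK, hpre, hc, hS, hcs⟩
  suffices h : ∃ N, ∀ depth, N ≤ depth →
      ∃ T' L, runCalls (reorder E p t depth) T cs = some (T', L) by
    obtain ⟨N, hN⟩ := h
    refine ⟨N + 1, fun depth hd => ?_⟩
    obtain ⟨d, rfl⟩ := Nat.exists_eq_add_of_le' (le_trans (by omega : 1 ≤ N + 1) hd)
    obtain ⟨T', L, h4⟩ := hN d (by omega)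
    rw [h3, h4]
    exact ⟨_, _, rfl⟩
  -- the first recursive call is shorter, and after it the potential is larger
  obtain ⟨l, d, hl, hd, hne⟩ := hcs.last
  obtain ⟨e, l', rfl⟩ : ∃ e l', l = e :: l' := by
    obtain ⟨s, hs⟩ := h0
    obtain ⟨w, hw⟩ := Finset.nonempty_iff_ne_empty.2 hs
    obtain ⟨e, he, -⟩ := hcs.before l d [] hl s (hd s) w hw (by
      rw [hd]
      exact (hS.sub s w hw).2)
    cases l with
    | nil => simp at he
    | cons e l' => exact ⟨e, l', rfl⟩
  rw [List.cons_append] at hl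
  have he : e ∈ cs := by simp [hl]
  have hfix : Fixes T c T := fun _ _ _ => rfl
  have hpe := hN.pre_child .refl hfix he
  have hlt : ∀ T₁, Φ T < Φ T₁ → ∀ c' : Call V, (B - Φ T₁) * (n + 1) +
      ((T₁ c'.v : ℕ) - (T₁ c'.u : ℕ)) < m := by
    intro T₁ h c'
    have h5 := hB T₁
    have h6 : B - Φ T₁ + 1 ≤ B - Φ T := by omega
    have h7 := Nat.mul_le_mul_right (n + 1) h6
    have h8 := (T₁ c'.v).2
    rw [add_mul] at h7
    omega
  have hdist : (T e.v : ℕ) - (T e.u : ℕ) < (T c.v : ℕ) - (T c.u : ℕ) := by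
    obtain ⟨s, hs⟩ := hne e (by simp)
    have h5 := hcs.tip_ge hpre.top hS he
    have h6 : pos s T (c.tip s) ≠ pos s T (e.tip s) := fun h =>
      hs (T.injective (eq_of_pos_eq h)).symm
    have h7 := h5 true
    have h8 := h5 false
    have h9 : (T c.u : ℕ) < T c.v := hc
    cases s <;> simp only [pos, Call.tip] at h6 h7 h8 <;> omega
  rw [hl]
  refine runCalls_cons_terminates (ih _ (by omega) T e hpe rfl) fun T₁ k L h => ?_
  have hb := reorder_basic hK hp h hpe
  refine runCalls_terminates
    (I := fun T₁ => Reach E K T T₁ ∧ Fixes T c T₁ ∧ Φ T < Φ T₁)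
    ⟨hb.reach, hN.fixes_trans hfix he hb.fixes,
      lt_of_transGen_legal hΦ (hb.transGen (hcs.lt e he))⟩ ?_ ?_
  · rintro c' hc' T₂ k T₃ L ⟨hr, hf, h5⟩ h6
    have hc'' : c' ∈ cs := by rw [hl]; exact List.mem_cons_of_mem _ hc'
    have hb' := reorder_basic hK hp h6 (hN.pre_child hr hf hc'')
    exact ⟨hr.trans hb'.reach, hN.fixes_trans hf hc'' hb'.fixes,
      h5.trans_le (hb'.reach.le_of_legal hΦ)⟩
  · rintro c' hc' T₂ ⟨hr, hf, h5⟩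
    have hc'' : c' ∈ cs := by rw [hl]; exact List.mem_cons_of_mem _ hc'
    exact ih _ (hlt T₂ h5 c') T₂ c' (hN.pre_child hr hf hc'') rfl

end Termination

end OnlineTopSort

namespace OnlineTopSort

/-! ### Charging the counted calls to the weight `Ω`. -/

section Counting

variable {V : Type*} {n : ℕ} {E : V → V → Prop} {K : Bool → V → Prop} {t : ℕ → ℝ} {p : ℕ}
  {T T₁ T' : Order V n} {c c' : Call V} {S : Bool → Finset V} {I : Bool → Finset ℕ}
  {cs : List (Call V)} {L : List (CallRecord V)}

/-- `countBothA` for `true` and `countBothB` for `false`. -/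
def countBoth : Bool → ℕ → List (CallRecord V) → ℕ
  | true, i, L => countBothA i L
  | false, i, L => countBothB i L

lemma countBoth_nil (s : Bool) (i : ℕ) : countBoth s i ([] : List (CallRecord V)) = 0 := by
  cases s <;> rfl

lemma countBoth_append (s : Bool) (i : ℕ) (L₁ L₂ : List (CallRecord V)) :
    countBoth s i (L₁ ++ L₂) = countBoth s i L₁ + countBoth s i L₂ := by
  cases s <;> simp [countBoth, countBothA, countBothB]

lemma countBoth_cons (s : Bool) (i : ℕ) (c : Call V) (I : Bool → Finset ℕ)
    (L : List (CallRecord V)) : countBoth s i (⟨c, I true, I false⟩ :: L) =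
      countBoth s i L + if i ∈ I s ∧ i + 1 ∈ I s then 1 else 0 := by
  cases s <;> simp [countBoth, countBothA, countBothB, List.countP_cons]

lemma countBoth_exit (s : Bool) (i : ℕ) (c : Call V) :
    countBoth s i [(⟨c, ∅, ∅⟩ : CallRecord V)] = 0 := by
  cases s <;> simp [countBoth, countBothA, countBothB]

/-- `Ω` never decreases, and increases at least by the distance of the swapped vertices if that is
at most `b`. -/
def IsWeight (E : V → V → Prop) (K : Bool → V → Prop) (b : ℝ) (Ω : Order V n → ℝ) : Prop :=
  ∀ T c T', IsTopOrder E T → Swaps E K T c T' →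
    Ω T ≤ Ω T' ∧ (c.len T ≤ b → c.len T ≤ Ω T' - Ω T)

lemma IsWeight.le_of_reach {b : ℝ} {Ω : Order V n → ℝ} (hΩ : IsWeight E K b Ω) (hK : Cones E K)
    (hT : IsTopOrder E T) (h : Reach E K T T') : Ω T ≤ Ω T' := by
  induction h with
  | refl => exact le_rfl
  | tail h₀ h ih =>
    obtain ⟨c, hc⟩ := h
    exact ih.trans (hΩ _ _ _ (Reach.isTopOrder hK h₀ hT) hc).1

/-- What is proved about the number of calls with two computed sets on the side `s` that are made
by an execution of `c`. -/
structure Counted (E : V → V → Prop) (t : ℕ → ℝ) (s : Bool) (i : ℕ) (Ω : Order V n → ℝ)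
    (T : Order V n) (c : Call V) (T' : Order V n) (L : List (CallRecord V)) : Prop where
  bound : t i * countBoth s i L ≤ 2 * (Ω T' - Ω T)
  flag : c.flag s = true → countBoth s i L = 0
  bound_of_clear : Clear E s T c → t i * countBoth s i L ≤ Ω T' - Ω T
  tip : Clear E s T c → T c.u < T c.v → pos s T' (c.tip s) = pos s T (c.tip !s)
  move : Clear E s T c → c.len T ≤ t (i + 1) →
    ((pos s T' (c.tip s) - pos s T (c.tip s) : ℤ) : ℝ) ≤ Ω T' - Ω T

lemma counted_exit {s : Bool} {i : ℕ} {Ω : Order V n → ℝ} (hc : T c.v ≤ T c.u) :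
    Counted E t s i Ω T c T [⟨c, ∅, ∅⟩] := by
  refine ⟨?_, fun _ => countBoth_exit s i c, ?_, fun _ h => absurd h hc.not_gt, ?_⟩ <;>
    simp [countBoth_exit]

lemma counted_swap {s : Bool} {i : ℕ} {Ω : Order V n → ℝ} (hT : IsTopOrder E T)
    (hS : Selection E t p T c S I) (h : Swaps E K T c T')
    (hΩ : IsWeight E K (t (i + 1)) Ω) : Counted E t s i Ω T c T' [⟨c, I true, I false⟩] := by
  obtain ⟨h1, h2⟩ := hΩ T c T' hT h
  have htip := pos_congr (s := s) (h.apply_tip s)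
  have hb : t i * countBoth s i [(⟨c, I true, I false⟩ : CallRecord V)] ≤ Ω T' - Ω T := by
    rw [countBoth_cons, countBoth_nil]
    split_ifs with hI
    · have h3 := hS.len s i hI.1 hI.2
      have h4 := h2 h3.2
      simp only [zero_add, Nat.cast_one, mul_one]
      linarith
    · simpa using h1
  refine ⟨by linarith, fun hf => ?_, fun _ => hb, fun _ _ => htip, fun _ hl => ?_⟩
  · rw [countBoth_cons, countBoth_nil, if_neg]
    rintro ⟨h3, h4⟩
    have := hS.flag s i h3 h4
    simp [this] at hf
  · rw [htip, ← c.len_eq]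
    exact h2 hl

namespace Node

variable {P : Order V n → Call V → Order V n → List (CallRecord V) → Prop}

lemma len_le (h : Node E K t p T c S I cs) (hf : Fixes T c T₁) (hc' : c' ∈ cs) :
    c'.len T₁ ≤ c.len T := by
  have h1 := h.tip_ge hf hc' true
  have h2 := h.tip_le hf hc' true
  simp only [Call.tip, Bool.not_true] at h1 h2
  simp only [Call.len]
  exact_mod_cast (by omega)

/-- If all neighbours of the end `s` are selected, then they have been moved away when the
recursive calls with this end are made. -/
lemma clear_child (h : Node E K t p T c S I cs)
    (hP : ∀ T c T' L, P T c T' L → Pre E K T c → Basic E K T c T') {s : Bool}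
    (hfull : ∀ w, Rel s E (c.tip s) w → pos s T w < pos s T (c.tip !s) → w ∈ S s)
    {l₁ l₂ : List (Call V)} (hcs : cs = l₁ ++ c' :: l₂) (hc' : c'.tip s = c.tip s)
    (hs : Steps P T l₁ T₁ L) : Clear E s T₁ c' := by
  have hl₁ : l₁ ⊆ cs := by simp [hcs]
  have hmem : c' ∈ cs := by simp [hcs]
  obtain ⟨hr, hf⟩ := h.within hP hl₁ hs
  intro w hw
  by_contra! hlt
  rw [hc'] at hw
  have hwS := hfull w hw (h.lt_of_lt hf hmem hw hlt)
  have hKw : K s w := h.cones.closed s _ _ (h.pre.cone s) hw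
  have hKf : K (!s) (c'.tip !s) := h.cone hmem !s
  -- If `w` was initially before the far end of `c'`, an earlier call with these two ends moved it
  -- past. In either case it stays past, since the two cones move in opposite directions.
  rcases lt_or_ge (pos s T w) (pos s T (c'.tip !s)) with h1 | h1
  · obtain ⟨d, hd, hd1, hd2⟩ := h.exp.before l₁ c' l₂ hcs s hc' w hwS h1
    obtain ⟨a, b, rfl⟩ := List.append_of_mem hd
    obtain ⟨T₂, L₁, L₂, h2, ⟨T₃, L₃, L₄, h3, h4, -⟩, -⟩ := hs.append
    have ha : a ⊆ cs := fun x hx => hl₁ (by simp [hx])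
    have hb : b ⊆ cs := fun x hx => hl₁ (by simp [hx])
    have hdm : d ∈ cs := hl₁ (by simp)
    obtain ⟨hr₂, hf₂⟩ := h.within hP ha h2
    have hbd := hP _ _ _ _ h3 (h.pre_child hr₂ hf₂ hdm)
    have hsep := (pos_tip_gt s).2 hbd.sep
    rw [hd1, hd2] at hsep
    have h5 : Reach E K T T₃ ∧ Fixes T c T₃ :=
      ⟨hr₂.trans hbd.reach, h.fixes_trans hf₂ hdm hbd.fixes⟩
    have h6 : Reach E K T₃ T₁ ∧ Fixes T c T₁ := by
      refine h4.invariant (I := fun T₁ => Reach E K T₃ T₁ ∧ Fixes T c T₁) ⟨.refl, h5.2⟩ ?_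
      rintro e he T₄ T₅ L' ⟨h7, h8⟩ h9
      have hb' := hP _ _ _ _ h9 (h.pre_child (h5.1.trans h7) h8 (hb he))
      exact ⟨h7.trans hb'.reach, h.fixes_trans h8 (hb he) hb'.fixes⟩
    have h7 := h6.1.pos_le h.cones hKw
    have h8 := h6.1.pos_ge h.cones (s := s) hKf
    omega
  · have h7 := hr.pos_le h.cones hKw
    have h8 := hr.pos_ge h.cones (s := s) hKf
    omega

/-- Before the last call, the far end of `c` retreats only in calls whose end `s` is a selected
vertex, and these change nothing before that vertex, which itself never falls below `m`. -/
lemma far_ge (h : Node E K t p T c S I cs)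
    (hP : ∀ T c T' L, P T c T' L → Pre E K T c → Basic E K T c T') {s : Bool} {m : ℤ}
    (hm : ∀ w ∈ S s, m ≤ pos s T w) (hm' : m ≤ pos s T (c.tip !s)) {l : List (Call V)}
    (hl : l ⊆ cs) (hne : ∀ c' ∈ l, ∃ r, c'.tip r ≠ c.tip r) (hs : Steps P T l T₁ L) :
    m ≤ pos s T₁ (c.tip !s) := by
  refine (hs.invariant
    (I := fun T₁ => Reach E K T T₁ ∧ Fixes T c T₁ ∧ m ≤ pos s T₁ (c.tip !s))
    ⟨.refl, fun _ _ _ => rfl, hm'⟩ ?_).2.2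
  rintro c' hc' T₂ T₃ L' ⟨hr, hf, h1⟩ h2
  have hpre := h.pre_child hr hf (hl hc')
  have hb := hP _ _ _ _ h2 hpre
  refine ⟨hr.trans hb.reach, h.fixes_trans hf (hl hc') hb.fixes, ?_⟩
  rcases h.exp.tip c' (hl hc') s with h3 | h3
  · obtain ⟨r, hr'⟩ := hne c' hc'
    have hrs : r = !s := by
      by_contra hrs
      have : r = s := by cases r <;> cases s <;> simp_all
      exact hr' (this ▸ h3)
    subst hrs
    have h4 := ((h.exp.tip c' (hl hc') !s).resolve_left hr')
    have h5 := hpre.top.pos_lt (h.sel.sub (!s) _ h4).1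
    rw [pos_congr (hb.fixes (!s) _ h5)]
    exact h1
  · rcases lt_or_ge (pos s T₂ (c.tip !s)) (pos s T₂ (c'.tip s)) with h4 | h4
    · rw [pos_congr (hb.fixes s _ h4)]
      exact h1
    · have h5 := hb.fixes.le_pos h4
      have h6 := hr.pos_le h.cones (h.cone (hl hc') s)
      have h7 := hm _ h3
      omega

/-- The last recursive call has the ends of `c` and is clear by then, so it takes the end `s` to the
place of the far end, unless it is already past it. `far_ge` bounds that place. -/
lemma tip_ge_of_full (h : Node E K t p T c S I cs)
    (hP : ∀ T c T' L, P T c T' L → Pre E K T c → Basic E K T c T') {s : Bool} {i : ℕ}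
    {Ω : Order V n → ℝ}
    (hC : ∀ T c T' L, P T c T' L → Pre E K T c → Counted E t s i Ω T c T' L)
    (hfull : ∀ w, Rel s E (c.tip s) w → pos s T w < pos s T (c.tip !s) → w ∈ S s) {m : ℤ}
    (hm : ∀ w ∈ S s, m ≤ pos s T w) (hm' : m ≤ pos s T (c.tip !s)) (hs : Steps P T cs T' L) :
    m ≤ pos s T' (c.tip s) := by
  obtain ⟨l, d, hl, hd, hne⟩ := h.exp.last
  have hls : l ⊆ cs := by simp [hl]
  have hdm : d ∈ cs := by simp [hl]
  rw [hl] at hs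
  obtain ⟨T₂, L₁, L₂, h1, ⟨T₃, L₃, L₄, h2, ⟨rfl, rfl⟩, rfl⟩, rfl⟩ := hs.append
  obtain ⟨hr, hf⟩ := h.within hP hls h1
  have hpre := h.pre_child hr hf hdm
  have h3 := h.far_ge hP hm hm' hls hne h1
  have h4 := h.clear_child hP hfull hl (hd s) h1
  rcases lt_or_ge (T₂ d.u) (T₂ d.v) with h5 | h5
  · have h6 := (hC _ _ _ _ h2 hpre).tip h4 h5
    rw [hd s, hd !s] at h6
    omega
  · have h6 := (hP _ _ _ _ h2 hpre).reach.pos_le h.cones (h.pre.cone s)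
    have h7 : pos s T₂ (d.tip !s) ≤ pos s T₂ (d.tip s) := by
      by_contra! h8
      exact absurd ((pos_tip_lt s).1 h8) h5.not_gt
    rw [hd s, hd !s] at h7
    omega

lemma steps_bound {s : Bool} {i : ℕ} {Ω : Order V n → ℝ} {f : Order V n → ℝ} {a b : ℝ}
    (hs : Steps (fun T _ T' L => f T' - f T + a * countBoth s i L ≤ b * (Ω T' - Ω T))
      T cs T' L) : f T' - f T + a * countBoth s i L ≤ b * (Ω T' - Ω T) := by
  induction cs generalizing T L with
  | nil =>
    obtain ⟨rfl, rfl⟩ := hs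
    simp [countBoth_nil]
  | cons c cs ih =>
    obtain ⟨T₁, L₁, L₂, h1, h2, rfl⟩ := hs
    have h3 := ih h2
    rw [countBoth_append]
    push_cast
    linarith

lemma counted (h : Node E K t p T c S I cs)
    (hP : ∀ T c T' L, P T c T' L → Pre E K T c → Basic E K T c T') {s : Bool} {i : ℕ}
    {Ω : Order V n → ℝ} (hΩ : IsWeight E K (t (i + 1)) Ω)
    (hC : ∀ T c T' L, P T c T' L → Pre E K T c → Counted E t s i Ω T c T' L)
    (hs : Steps P T cs T' L) : Counted E t s i Ω T c T' (⟨c, I true, I false⟩ :: L) := by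
  have hwithin : ∀ l₁ c' l₂, cs = l₁ ++ c' :: l₂ → ∀ T₁ L₁, Steps P T l₁ T₁ L₁ →
      Reach E K T T₁ ∧ Fixes T c T₁ ∧ c' ∈ cs ∧ Pre E K T₁ c' := by
    intro l₁ c' l₂ hcs T₁ L₁ h1
    obtain ⟨hr, hf⟩ := h.within hP (by simp [hcs]) h1
    have hc' : c' ∈ cs := by simp [hcs]
    exact ⟨hr, hf, hc', h.pre_child hr hf hc'⟩
  have hfix := (h.within hP (List.Subset.refl _) hs).2
  have hmono : Ω T ≤ Ω T' := hΩ.le_of_reach h.cones h.pre.top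
    (h.within hP (List.Subset.refl _) hs).1
  -- without any information on the node, the bounds of the recursive calls add up
  have hsum : t i * countBoth s i L ≤ 2 * (Ω T' - Ω T) := by
    have := steps_bound (f := fun _ => 0) (a := t i) (b := 2) (s := s) (i := i) (Ω := Ω)
      (hs.refine fun l₁ c' l₂ hcs T₁ L₁ T₂ L₂ h1 h2 => by
        obtain ⟨hr, hf, hc', hpre⟩ := hwithin l₁ c' l₂ hcs T₁ L₁ h1
        simpa using (hC _ _ _ _ h2 hpre).bound)
    simpa using this
  -- if all neighbours of the end are selected, then also its move can be paid for
  have hstep : (∀ w, Rel s E (c.tip s) w → pos s T w < pos s T (c.tip !s) → w ∈ S s) →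
      c.len T ≤ t (i + 1) → Steps (fun T₁ _ T₂ L =>
        ((pos s T₂ (c.tip s) : ℝ) - pos s T₁ (c.tip s)) + 0 * countBoth s i L ≤
          1 * (Ω T₂ - Ω T₁) ∧
        ((pos s T₂ (c.tip s) : ℝ) - pos s T₁ (c.tip s)) + t i * countBoth s i L ≤
          2 * (Ω T₂ - Ω T₁)) T cs T' L := by
    intro hfull hlen
    refine hs.refine fun l₁ c' l₂ hcs T₁ L₁ T₂ L₂ h1 h2 => ?_
    obtain ⟨hr, hf, hc', hpre⟩ := hwithin l₁ c' l₂ hcs T₁ L₁ h1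
    have hcc := hC _ _ _ _ h2 hpre
    have hb := hP _ _ _ _ h2 hpre
    -- A recursive call with the same end is clear, so its count and its move cost one gain each.
    -- Any other starts strictly beyond the end `c.tip s`, which therefore does not move, and both
    -- gains are available for the count.
    by_cases h3 : c'.tip s = c.tip s
    · have h4 := h.clear_child hP hfull hcs h3 h1
      have h5 := hcc.move h4 ((h.len_le hf hc').trans hlen)
      have h6 := hcc.bound_of_clear h4
      rw [h3] at h5
      push_cast at h5
      constructor <;> linarith
    · have h4 := (h.exp.tip c' hc' s).resolve_left h3
      have h5 := hpre.top.pos_lt (h.sel.sub s _ h4).1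
      rw [pos_congr (hb.fixes s _ h5)]
      have h6 := hΩ.le_of_reach h.cones hpre.top hb.reach
      have h7 := hcc.bound
      constructor <;> linarith
  -- With nothing selected on the side `s`, every recursive call carries the flag of that side and
  -- counts nothing.
  have hzero : S s = ∅ → countBoth s i L = 0 := by
    intro h0
    have h1 := steps_bound (f := fun _ => 0) (a := 1) (b := 0) (s := s) (i := i) (Ω := Ω)
      (hs.refine fun l₁ c' l₂ hcs T₁ L₁ T₂ L₂ h1 h2 => by
        obtain ⟨hr, hf, hc', hpre⟩ := hwithin l₁ c' l₂ hcs T₁ L₁ h1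
        have hflag : c'.flag s = true := by
          refine (h.exp.flag c' hc' s).2 ⟨(h.exp.tip c' hc' s).resolve_right ?_, h0⟩
          simp [h0]
        simp [(hC _ _ _ _ h2 hpre).flag hflag])
    have h2 : ((countBoth s i L : ℕ) : ℝ) ≤ 0 := by simpa using h1
    exact_mod_cast le_antisymm h2 (by positivity)
  have hempty : Clear E s T c → S s = ∅ := by
    intro hcl
    rw [Finset.eq_empty_iff_forall_notMem]
    intro w hw
    have h1 := h.sel.sub s w hw
    have h2 := hcl w h1.1
    omega
  have htip : Clear E s T c → pos s T' (c.tip s) = pos s T (c.tip !s) := by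
    intro hcl
    have h0 := hempty hcl
    refine le_antisymm (hfix.pos_le ((pos_tip_lt s).2 h.lt).le) ?_
    refine h.tip_ge_of_full hP hC (fun w hw hlt => ?_) (by simp [h0]) le_rfl hs
    have := hcl w hw
    omega
  have hmove : Clear E s T c → c.len T ≤ t (i + 1) →
      ((pos s T' (c.tip s) - pos s T (c.tip s) : ℤ) : ℝ) ≤ Ω T' - Ω T := by
    intro hcl hlen
    have h1 := steps_bound (f := fun T => (pos s T (c.tip s) : ℝ))
      ((hstep (fun w hw hlt => by have := hcl w hw; omega) hlen).mono fun _ _ _ _ h => h.1)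
    push_cast
    linarith
  refine ⟨?_, ?_, ?_, fun hcl _ => htip hcl, hmove⟩
  · rw [countBoth_cons]
    split_ifs with hI
    · have hlen := h.sel.len s i hI.1 hI.2
      have hfull := h.sel.full s i hI.1 hI.2
      -- Positions are integers, so a distance greater than `t i` is at least `⌊t i⌋ + 1`. This move
      -- pays for the call `c` itself.
      have hm : pos s T (c.tip s) + ⌊t i⌋ + 1 ≤ pos s T' (c.tip s) := by
        refine h.tip_ge_of_full hP hC hfull (fun w hw => ?_) ?_ hs
        · have := Int.floor_lt.2 (h.sel.far s i hI.1 hI.2 w hw)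
          omega
        · have h1 := hlen.1
          rw [c.len_eq T s] at h1
          have := Int.floor_lt.2 h1
          omega
      have h1 := steps_bound (f := fun T => (pos s T (c.tip s) : ℝ))
        ((hstep hfull hlen.2).mono fun _ _ _ _ h => h.2)
      have h2 := Int.lt_floor_add_one (t i)
      have h3 : (pos s T (c.tip s) : ℝ) + ⌊t i⌋ + 1 ≤ pos s T' (c.tip s) := by exact_mod_cast hm
      push_cast
      linarith
    · simpa using hsum
  · intro hf
    have hcl := h.pre.clear s hf
    rw [countBoth_cons, hzero (hempty hcl), if_neg]
    rintro ⟨h3, h4⟩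
    have := h.sel.flag s i h3 h4
    simp [this] at hf
  · intro hcl
    rw [countBoth_cons, hzero (hempty hcl)]
    split_ifs with hI
    · have hlen := h.sel.len s i hI.1 hI.2
      have h1 := hmove hcl hlen.2
      rw [htip hcl, ← c.len_eq] at h1
      simp only [zero_add, Nat.cast_one, mul_one]
      linarith
    · simpa using hmono

end Node

theorem reorder_counted [Fintype V] (hK : Cones E K) (hp : t (p + 1) = n) {s : Bool} {i : ℕ}
    {Ω : Order V n → ℝ} (hΩ : IsWeight E K (t (i + 1)) Ω) {depth : ℕ}
    (h : reorder E p t depth T c = some (T', L)) (hpre : Pre E K T c) :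
    Counted E t s i Ω T c T' L := by
  induction depth generalizing T c T' L with
  | zero => simp [reorder] at h
  | succ depth ih =>
    rcases reorder_cases hK hp h hpre with
      ⟨hc, rfl, rfl⟩ | ⟨S, I, hc, hS, ⟨hsw, -, rfl⟩ | ⟨d, cs, L', hd, hN, hs, rfl⟩⟩
    · exact counted_exit hc
    · exact counted_swap hpre.top hS hsw hΩ
    · obtain rfl : depth = d := by omega
      exact hN.counted (fun _ _ _ _ h1 h2 => reorder_basic hK hp h1 h2) hΩ
        (fun _ _ _ _ h1 h2 => ih h1 h2) hs

end Counting

end OnlineTopSort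

namespace OnlineTopSort

/-! ### The potential and its growth under swaps. -/

section Potential

variable {V : Type*} [Fintype V] {n : ℕ} {E : V → V → Prop} {K : Bool → V → Prop}
  {T T' : Order V n} {c : Call V}

/-- The correlation of the order `T` with the final order `F`. -/
def correlation (F T : Order V n) : ℕ := ∑ x, (T x : ℕ) * (F x : ℕ)

lemma correlation_le (F T : Order V n) : correlation F T ≤ n * (n * n) := by
  have hcard : Fintype.card V = n := by simpa using Fintype.card_congr T
  calc correlation F T ≤ ∑ _x : V, n * n :=
        Finset.sum_le_sum fun x _ => Nat.mul_le_mul (T x).2.le (F x).2.le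
    _ = n * (n * n) := by simp [hcard]

lemma Swaps.correlation_eq (h : Swaps E K T c T') (F : Order V n) :
    (correlation F T' : ℝ) =
      correlation F T + c.len T * (((F c.u : ℕ) : ℝ) - ((F c.v : ℕ) : ℝ)) := by
  have hne : c.u ≠ c.v := fun he => by
    have := h.lt
    rw [he] at this
    exact lt_irrefl _ this
  have h1 : T' c.u = T c.v := h.apply_tip true
  have h2 : T' c.v = T c.u := h.apply_tip false
  have h3 : ∑ x, (((T' x : ℕ) : ℝ) - (T x : ℕ)) * ((F x : ℕ) : ℝ) =
      (((T' c.u : ℕ) : ℝ) - (T c.u : ℕ)) * ((F c.u : ℕ) : ℝ) +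
      (((T' c.v : ℕ) : ℝ) - (T c.v : ℕ)) * ((F c.v : ℕ) : ℝ) := by
    refine Fintype.sum_eq_add _ _ hne fun x hx => ?_
    rw [h.apply_of_ne (fun s => by cases s; exacts [hx.2, hx.1])]
    simp
  simp only [sub_mul, Finset.sum_sub_distrib] at h3
  rw [h1, h2] at h3
  simp only [correlation, Call.len, pos]
  push_cast
  linarith

open Classical in
/-- The pairs in the relation `R` whose positions in `F` differ by at most `k`. -/
noncomputable def closePairs (F : Order V n) (k : ℝ) (R : V → V → Prop) : Finset (V × V) :=
  Finset.univ.filter fun z => F z.1 < F z.2 ∧ ((F z.2 : ℕ) : ℝ) - ((F z.1 : ℕ) : ℝ) ≤ k ∧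
    R z.1 z.2

/-- A pair is determined by its lower position and its gap, which is one of `1, …, ⌊k⌋`. -/
lemma card_closePairs_le (F : Order V n) {k : ℝ} (hk : 0 ≤ k) (R : V → V → Prop) :
    ((closePairs F k R).card : ℝ) ≤ n * k := by
  classical
  have h1 : (closePairs F k R).card ≤
      ((Finset.range n) ×ˢ (Finset.range ⌊k⌋₊)).card := by
    refine Finset.card_le_card_of_injOn
      (fun z => ((F z.1 : ℕ), (F z.2 : ℕ) - (F z.1 : ℕ) - 1)) ?_ ?_
    · rintro ⟨x, y⟩ hz
      simp only [closePairs, Finset.coe_filter, Finset.mem_univ, true_and, Set.mem_ofPred_eq] at hz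
      obtain ⟨h1, h2, -⟩ := hz
      have h1' : (F x : ℕ) < F y := h1
      have h3 : (F y : ℕ) - (F x : ℕ) ≤ ⌊k⌋₊ := by
        refine Nat.le_floor ?_
        rw [Nat.cast_sub h1'.le]
        exact h2
      simp only [Finset.coe_product, Set.mem_prod, Finset.coe_range, Set.mem_Iio]
      exact ⟨(F x).2, by omega⟩
    · rintro ⟨x, y⟩ hz ⟨x', y'⟩ hz' he
      simp only [closePairs, Finset.coe_filter, Finset.mem_univ, true_and, Set.mem_ofPred_eq]
        at hz hz'
      have h1 : (F x : ℕ) < F y := hz.1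
      have h2 : (F x' : ℕ) < F y' := hz'.1
      simp only [Prod.mk.injEq] at he ⊢
      exact ⟨F.injective (Fin.ext he.1), F.injective (Fin.ext (by omega))⟩
  rw [Finset.card_product, Finset.card_range, Finset.card_range] at h1
  calc ((closePairs F k R).card : ℝ) ≤ ((n * ⌊k⌋₊ : ℕ) : ℝ) := by exact_mod_cast h1
    _ = n * (⌊k⌋₊ : ℝ) := by push_cast; ring
    _ ≤ n * k := by gcongr; exact Nat.floor_le hk

lemma closePairs_mono (F : Order V n) (k : ℝ) {R R' : V → V → Prop} (h : ∀ x y, R x y → R' x y) :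
    closePairs F k R ⊆ closePairs F k R' := by
  intro z hz
  simp only [closePairs, Finset.mem_filter, Finset.mem_univ, true_and] at hz ⊢
  exact ⟨hz.1, hz.2.1, h _ _ hz.2.2⟩

/-- The potential of the order `T` when the pairs in `R` are settled. -/
noncomputable def potential (F : Order V n) (b k : ℝ) (R : V → V → Prop) (T : Order V n) : ℝ :=
  b * (closePairs F k R).card + correlation F T / k

lemma potential_mono (F : Order V n) {b : ℝ} (hb : 0 ≤ b) (k : ℝ) {R R' : V → V → Prop}
    (h : ∀ x y, R x y → R' x y) (T : Order V n) :
    potential F b k R T ≤ potential F b k R' T := by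
  have : ((closePairs F k R).card : ℝ) ≤ (closePairs F k R').card := by
    exact_mod_cast Finset.card_le_card (closePairs_mono F k h)
  simp only [potential]
  gcongr

/-- The two terms are at most `b * n * k` and `n³ / k`; the choice `k = n / √b` makes both bounds
equal to `n² √b`. -/
lemma potential_le (F : Order V n) {b : ℝ} (hb : 0 < b) (R : V → V → Prop) (T : Order V n) :
    potential F b (n / √b) R T ≤ 2 * ((n : ℝ) ^ 2 * √b) := by
  have hsb : 0 < √b := Real.sqrt_pos.2 hb
  have h1 := card_closePairs_le F (k := n / √b) (by positivity) R
  have h2 : (correlation F T : ℝ) ≤ n * (n * n) := by exact_mod_cast correlation_le F T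
  have h3 : b * ((closePairs F (n / √b) R).card : ℝ) ≤ (n : ℝ) ^ 2 * √b := by
    calc b * ((closePairs F (n / √b) R).card : ℝ) ≤ b * (n * (n / √b)) := by gcongr
      _ = (n : ℝ) ^ 2 * √b := by
        have : b = √b * √b := (Real.mul_self_sqrt hb.le).symm
        nth_rewrite 1 [this]
        field_simp
  have h4 : (correlation F T : ℝ) / (n / √b) ≤ (n : ℝ) ^ 2 * √b := by
    rcases Nat.eq_zero_or_pos n with h0 | h0
    · subst h0
      simp
    · have h0' : (0 : ℝ) < n := by exact_mod_cast h0
      calc (correlation F T : ℝ) / (n / √b) ≤ (n * (n * n)) / (n / √b) := by gcongr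
        _ = (n : ℝ) ^ 2 * √b := by field_simp
  simp only [potential]
  linarith

/-- The pairs that are settled during the insertion of an edge. -/
def Settled (E : V → V → Prop) (K : Bool → V → Prop) (T : Order V n) (y x : V) : Prop :=
  Relation.TransGen E y x ∨ (K false y ∧ K true x ∧ T y < T x)

omit [Fintype V] in
lemma IsTopOrder.lt_of_transGen (hT : IsTopOrder E T) {x y : V} (h : Relation.TransGen E x y) :
    T x < T y := by
  induction h with
  | single h => exact hT _ _ h
  | tail _ h ih => exact ih.trans (hT _ _ h)

omit [Fintype V] in
lemma Swaps.settled (hK : Cones E K) (h : Swaps E K T c T') {x y : V} (hxy : Settled E K T y x) :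
    Settled E K T' y x := by
  rcases hxy with h1 | ⟨h1, h2, h3⟩
  · exact Or.inl h1
  · refine Or.inr ⟨h1, h2, ?_⟩
    have h4 := h.pos_le hK h1
    have h5 := h.pos_le hK h2
    simp only [pos] at h4 h5
    rw [Fin.lt_def] at h3 ⊢
    omega

lemma Swaps.correlation_lt {F : Order V n} (h : Swaps E K T c T')
    (hF : ∀ x y, K true x → K false y → F y < F x) : correlation F T < correlation F T' := by
  have h1 := h.correlation_eq F
  have h2 : ((F c.v : ℕ) : ℝ) < (F c.u : ℕ) := by
    exact_mod_cast hF _ _ (h.cone true) (h.cone false)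
  have h3 : 0 < c.len T := by
    simp only [Call.len]
    exact_mod_cast sub_pos.2 (pos_true_lt.2 h.lt)
  have h4 := mul_pos h3 (sub_pos.2 h2)
  exact_mod_cast (by linarith : (correlation F T : ℝ) < correlation F T')

lemma isWeight_potential {F : Order V n} (hK : Cones E K)
    (hF : ∀ x y, K true x → K false y → F y < F x) {b k : ℝ} (hb : 0 ≤ b) (hk : 0 < n → 0 < k) :
    IsWeight E K b fun T => potential F b k (Settled E K T) T := by
  classical
  intro T c T' hT h
  have hk : 0 < k := hk (Fin.pos (T c.u))
  have hsub : closePairs F k (Settled E K T) ⊆ closePairs F k (Settled E K T') :=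
    closePairs_mono F k fun x y hxy => h.settled hK hxy
  have hcard : ((closePairs F k (Settled E K T)).card : ℝ) ≤
      (closePairs F k (Settled E K T')).card := by exact_mod_cast Finset.card_le_card hsub
  have hcorr : (correlation F T : ℝ) ≤ correlation F T' := by
    exact_mod_cast (h.correlation_lt hF).le
  have h1 : b * ((closePairs F k (Settled E K T)).card : ℝ) ≤
      b * (closePairs F k (Settled E K T')).card := by gcongr
  have h2 : (correlation F T : ℝ) / k ≤ correlation F T' / k := by gcongr
  have hFlt := hF _ _ (h.cone true) (h.cone false)
  refine ⟨add_le_add h1 h2, fun hlen => ?_⟩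
  simp only [potential]
  -- In the close case `(v, u)` is newly settled: beforehand `T u < T v`, which also rules out a
  -- path from `v` to `u`. In the far case the correlation alone pays.
  rcases le_or_gt (((F c.u : ℕ) : ℝ) - ((F c.v : ℕ) : ℝ)) k with hc | hc
  · have hlt : (closePairs F k (Settled E K T)).card <
        (closePairs F k (Settled E K T')).card := by
      refine Finset.card_lt_card (Finset.ssubset_iff_of_subset hsub |>.2 ⟨(c.v, c.u), ?_, ?_⟩)
      · simp only [closePairs, Finset.mem_filter, Finset.mem_univ, true_and]
        refine ⟨hFlt, hc, Or.inr ⟨h.cone false, h.cone true, ?_⟩⟩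
        exact h.basic.sep
      · simp only [closePairs, Finset.mem_filter, Finset.mem_univ, true_and, not_and]
        rintro - - (h3 | ⟨-, -, h3⟩)
        · exact absurd (hT.lt_of_transGen h3) h.lt.not_gt
        · exact absurd h3 h.lt.not_gt
    have hle : ((closePairs F k (Settled E K T)).card : ℝ) + 1 ≤
        (closePairs F k (Settled E K T')).card := by exact_mod_cast hlt
    have h3 := mul_le_mul_of_nonneg_left hle hb
    linarith
  · have h3 := h.correlation_eq F
    have h4 : 0 < c.len T := by
      simp only [Call.len]
      exact_mod_cast sub_pos.2 (pos_true_lt.2 h.lt)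
    have h5 : (correlation F T : ℝ) / k + c.len T ≤ correlation F T' / k := by
      rw [h3, add_div, mul_div_assoc]
      have : 1 ≤ (((F c.u : ℕ) : ℝ) - ((F c.v : ℕ) : ℝ)) / k := (one_le_div hk).2 hc.le
      have := mul_le_mul_of_nonneg_left this h4.le
      linarith
    linarith

end Potential

/-! ### Inserting one edge, then a sequence of edges. -/

section Insertion

variable {V : Type*} {n : ℕ} {E : V → V → Prop} {t : ℕ → ℝ} {p : ℕ} {a b : V}

/-- The graph after the insertion of the edge `a → b`. -/
abbrev addEdge (E : V → V → Prop) (a b : V) : V → V → Prop := fun x y => E x y ∨ (x = a ∧ y = b)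

/-- The descendants of the head and the ancestors of the tail of the edge `a → b`. -/
def edgeCone (E : V → V → Prop) (a b : V) : Bool → V → Prop
  | true, x => Relation.ReflTransGen E b x
  | false, x => Relation.ReflTransGen E x a

lemma edgeCone_lt {F : Order V n} (hF : IsTopOrder (addEdge E a b) F) {x y : V}
    (hx : edgeCone E a b true x) (hy : edgeCone E a b false y) : F y < F x := by
  have h1 : ∀ {x y}, Relation.ReflTransGen E x y → F x ≤ F y := by
    intro x y h
    induction h with
    | refl => exact le_rfl
    | tail _ h ih => exact ih.trans (hF _ _ (Or.inl h)).le
  exact (h1 hy).trans_lt ((hF a b (Or.inr ⟨rfl, rfl⟩)).trans_le (h1 hx))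

lemma cones_edgeCone {F : Order V n} (hF : IsTopOrder (addEdge E a b) F) :
    Cones E (edgeCone E a b) := by
  refine ⟨?_, ?_⟩
  · intro s x y hx hxy
    cases s
    · exact Relation.ReflTransGen.head hxy hx
    · exact Relation.ReflTransGen.tail hx hxy
  · intro s x hx hx'
    cases s
    · exact lt_irrefl _ (edgeCone_lt hF hx' hx)
    · exact lt_irrefl _ (edgeCone_lt hF hx hx')

/-- The new edge joins every vertex of the lower cone to every vertex of the upper one. This allows
pairs settled during the insertion to be carried over to the next one. -/
lemma transGen_addEdge_of_settled {T : Order V n} {x y : V}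
    (h : Settled E (edgeCone E a b) T y x) : Relation.TransGen (addEdge E a b) y x := by
  have hle : ∀ x y, E x y → addEdge E a b x y := fun _ _ => Or.inl
  rcases h with h | ⟨h1, h2, -⟩
  · exact Relation.TransGen.mono hle _ _ h
  · exact Relation.TransGen.trans_right (Relation.ReflTransGen.mono hle _ _ h1)
      (Relation.TransGen.trans_left (.single (Or.inr ⟨rfl, rfl⟩))
        (Relation.ReflTransGen.mono hle _ _ h2))

lemma pre_insert {T : Order V n} (hT : IsTopOrder E T) :
    Pre E (edgeCone E a b) T { u := b, v := a, f₁ := false, f₂ := false } := by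
  refine ⟨hT, ?_, ?_⟩ <;> intro s <;> cases s
  · exact Relation.ReflTransGen.refl
  · exact Relation.ReflTransGen.refl
  · simp [Call.flag]
  · simp [Call.flag]

variable [Fintype V]

lemma insertEdge_terminates {F T : Order V n} (hF : IsTopOrder (addEdge E a b) F)
    (hT : IsTopOrder E T) (hp : t (p + 1) = n) :
    ∃ N, ∀ depth, N ≤ depth → ∃ T' L, insertEdge E p t depth T a b = some (T', L) := by
  have hlt := fun x y => edgeCone_lt (x := x) (y := y) hF
  by_cases h : T b ≤ T a
  · obtain ⟨N, hN⟩ := reorder_terminates (cones_edgeCone hF) hp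
      (Φ := correlation F) (B := n * (n * n)) (fun T T' ⟨c, hc⟩ => hc.correlation_lt hlt)
      (correlation_le F) T _ (pre_insert hT)
    exact ⟨N, fun depth hd => by simpa only [insertEdge, if_pos h] using hN depth hd⟩
  · exact ⟨0, fun depth _ => ⟨T, [], by simp only [insertEdge, if_neg h]⟩⟩

lemma insertEdge_spec {F T T' : Order V n} (hF : IsTopOrder (addEdge E a b) F)
    (hT : IsTopOrder E T) (hp : t (p + 1) = n) {depth : ℕ} {L : List (CallRecord V)}
    (h : insertEdge E p t depth T a b = some (T', L)) :
    IsTopOrder (addEdge E a b) T' ∧ ∀ s i, 0 < t (i + 1) → t i * countBoth s i L ≤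
      2 * (potential F (t (i + 1)) (n / √(t (i + 1))) (Relation.TransGen (addEdge E a b)) T' -
        potential F (t (i + 1)) (n / √(t (i + 1))) (Relation.TransGen E) T) := by
  have hK := cones_edgeCone hF
  rw [insertEdge] at h
  split_ifs at h with hle
  · have hpre := pre_insert (a := a) (b := b) hT
    have hb := reorder_basic hK hp h hpre
    refine ⟨?_, fun s i hi => ?_⟩
    · rintro x y (hxy | ⟨rfl, rfl⟩)
      · exact hb.reach.isTopOrder hK hT x y hxy
      · exact hb.sep
    · have hΩ : IsWeight E (edgeCone E a b) (t (i + 1)) fun T =>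
          potential F (t (i + 1)) (n / √(t (i + 1))) (Settled E (edgeCone E a b) T) T :=
        isWeight_potential hK (fun x y => edgeCone_lt hF) hi.le fun hn => by positivity
      have h1 := (reorder_counted (s := s) (i := i) hK hp hΩ h hpre).bound
      have h2 := potential_mono F hi.le (n / √(t (i + 1)))
        (fun x y => transGen_addEdge_of_settled (a := a) (b := b) (E := E) (T := T')
          (y := x) (x := y)) T'
      have h3 := potential_mono F hi.le (n / √(t (i + 1)))
        (R' := Settled E (edgeCone E a b) T) (fun _ _ => Or.inl) T
      linarith
  · simp only [Option.some.injEq, Prod.mk.injEq] at h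
    obtain ⟨rfl, rfl⟩ := h
    refine ⟨?_, fun s i hi => ?_⟩
    · rintro x y (hxy | ⟨rfl, rfl⟩)
      · exact hT x y hxy
      · exact not_le.1 hle
    · have h3 := potential_mono F hi.le (n / √(t (i + 1)))
        (Relation.TransGen.mono (p := addEdge E a b) fun _ _ => Or.inl) T
      rw [countBoth_nil]
      push_cast
      linarith

/-- The count is bounded by what is left below the maximum of the potential, so that the bounds of
successive insertions telescope. A single `F`, compatible with all edges still to come, serves
throughout. -/
theorem insertEdges_spec {F : Order V n} (hp : t (p + 1) = n) (hpos : ∀ i ≤ p, 0 < t (i + 1))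
    (edges : List (V × V)) {T : Order V n} (hT : IsTopOrder E T)
    (hF : ∀ x y, E x y ∨ (x, y) ∈ edges → F x < F y) :
    ∃ N, ∀ depth, N ≤ depth → ∃ T' L, insertEdges p t depth E T edges = some (T', L) ∧
      ∀ i, i ≤ p → ∀ s, t i * countBoth s i L ≤ 2 * (2 * ((n : ℝ) ^ 2 * √(t (i + 1))) -
        potential F (t (i + 1)) (n / √(t (i + 1))) (Relation.TransGen E) T) := by
  classical
  induction edges generalizing E T with
  | nil =>
    refine ⟨0, fun _ _ => ⟨T, [], rfl, fun i hi s => ?_⟩⟩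
    have := potential_le F (hpos i hi) (Relation.TransGen E) T
    rw [countBoth_nil]
    push_cast
    linarith
  | cons e es ih =>
    obtain ⟨a, b⟩ := e
    have hF₁ : IsTopOrder (addEdge E a b) F := by
      rintro x y (h | ⟨rfl, rfl⟩)
      · exact hF x y (Or.inl h)
      · exact hF x y (Or.inr (by simp))
    have hF₂ : ∀ x y, addEdge E a b x y ∨ (x, y) ∈ es → F x < F y := by
      rintro x y (h | h)
      · exact hF₁ x y h
      · exact hF x y (Or.inr (by simp [h]))
    obtain ⟨N, hN⟩ := insertEdge_terminates hF₁ hT hp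
    have key : ∀ T' : Order V n, ∃ N, IsTopOrder (addEdge E a b) T' → ∀ depth, N ≤ depth →
        ∃ T'' L, insertEdges p t depth (addEdge E a b) T' es = some (T'', L) ∧
          ∀ i, i ≤ p → ∀ s, t i * countBoth s i L ≤ 2 * (2 * ((n : ℝ) ^ 2 * √(t (i + 1))) -
            potential F (t (i + 1)) (n / √(t (i + 1)))
              (Relation.TransGen (addEdge E a b)) T') := by
      intro T'
      by_cases h : IsTopOrder (addEdge E a b) T'
      · obtain ⟨N, hN⟩ := ih h hF₂
        exact ⟨N, fun _ => hN⟩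
      · exact ⟨0, fun h' => absurd h' h⟩
    choose N' hN' using key
    refine ⟨max N (Finset.univ.sup N'), fun depth hd => ?_⟩
    obtain ⟨T₁, L₁, h1⟩ := hN depth (le_trans (le_max_left _ _) hd)
    obtain ⟨hT₁, h2⟩ := insertEdge_spec hF₁ hT hp h1
    obtain ⟨T₂, L₂, h3, h4⟩ := hN' T₁ hT₁ depth
      ((Finset.le_sup (Finset.mem_univ T₁)).trans ((le_max_right _ _).trans hd))
    refine ⟨T₂, L₁ ++ L₂, by simp [insertEdges, h1, h3], fun i hi s => ?_⟩
    have h5 := h2 s i (hpos i hi)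
    have h6 := h4 i hi s
    rw [countBoth_append]
    push_cast
    linarith

/-- Acyclicity makes reachability a partial order, which extends to a linear one; `T` only supplies
the number of vertices. -/
lemma exists_isTopOrder (hE : Acyclic E) (T : Order V n) : ∃ F : Order V n, IsTopOrder E F := by
  classical
  have hpo : IsPartialOrder V (Relation.ReflTransGen E) :=
    { refl := fun _ => .refl
      trans := fun _ _ _ => .trans
      antisymm := fun x y h1 h2 => by
        rcases Relation.reflTransGen_iff_eq_or_transGen.1 h1 with h | h
        · exact h.symm
        · exact absurd (h.trans_left h2) (hE x) }
  obtain ⟨r, hr, hle⟩ := extend_partialOrder (Relation.ReflTransGen E)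
  let _ : LinearOrder V :=
    { le := r
      le_refl := hr.refl
      le_trans := hr.trans
      le_antisymm := hr.antisymm
      le_total := hr.total
      toDecidableLE := Classical.decRel _ }
  have hcard : Fintype.card V = n := by simpa using Fintype.card_congr T
  refine ⟨(Fintype.orderIsoFinOfCardEq V hcard).symm.toEquiv, fun x y hxy => ?_⟩
  have hlt : x < y := by
    refine lt_of_le_of_ne (hle _ _ (.single hxy)) ?_
    rintro rfl
    exact hE x (.single hxy)
  exact (Fintype.orderIsoFinOfCardEq V hcard).symm.strictMono hlt

end Insertion

end OnlineTopSort

theorem mainTheorem8 :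
    ∃ C : ℝ, 0 < C ∧
      ∀ (n : ℕ) (V : Type*) [Fintype V] (p : ℕ) (t : ℕ → ℝ),
        Real.sqrt n < t 0 →
        (∀ i, i ≤ p → t i < t (i + 1)) →
        t (p + 1) = n →
        ∀ (E₀ : V → V → Prop) (T₀ : OnlineTopSort.Order V n) (edges : List (V × V)),
          OnlineTopSort.IsTopOrder E₀ T₀ →
          OnlineTopSort.Acyclic (fun a b => E₀ a b ∨ (a, b) ∈ edges) →
          ∃ N : ℕ, ∀ depth, N ≤ depth →
            ∃ (T : OnlineTopSort.Order V n) (log : List (OnlineTopSort.CallRecord V)),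
              OnlineTopSort.insertEdges p t depth E₀ T₀ edges = some (T, log) ∧
              ∀ i, i ≤ p →
                (OnlineTopSort.countBothA i log : ℝ) ≤
                  C * ((n : ℝ) ^ 2 * Real.sqrt (t (i + 1)) / t i) ∧
                (OnlineTopSort.countBothB i log : ℝ) ≤
                  C * ((n : ℝ) ^ 2 * Real.sqrt (t (i + 1)) / t i) := by
  -- The constant is the factor `2` of `Counted.bound` times the factor `2` of `potential_le`.
  refine ⟨4, by norm_num, ?_⟩
  intro n V _ p t ht₀ ht hp E₀ T₀ edges hT₀ hE
  have hpos : ∀ i, i ≤ p + 1 → 0 < t i := by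
    intro i
    induction i with
    | zero => exact fun _ => (Real.sqrt_nonneg _).trans_lt ht₀
    | succ i ih => exact fun hi => (ih (by omega)).trans (ht i (by omega))
  obtain ⟨F, hF⟩ := OnlineTopSort.exists_isTopOrder hE T₀
  obtain ⟨N, hN⟩ := OnlineTopSort.insertEdges_spec (F := F) hp
    (fun i hi => hpos (i + 1) (by omega)) edges hT₀ hF
  refine ⟨N, fun depth hd => ?_⟩
  obtain ⟨T, log, h1, h2⟩ := hN depth hd
  refine ⟨T, log, h1, fun i hi => ?_⟩
  have hti := hpos i (by omega)
  have key : ∀ s, (OnlineTopSort.countBoth s i log : ℝ) ≤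
      4 * ((n : ℝ) ^ 2 * Real.sqrt (t (i + 1)) / t i) := by
    intro s
    have h3 := h2 i hi s
    have h4 : 0 ≤ OnlineTopSort.potential F (t (i + 1)) (n / √(t (i + 1)))
        (Relation.TransGen E₀) T₀ := by
      have := hpos (i + 1) (by omega)
      unfold OnlineTopSort.potential
      positivity
    rw [← mul_div_assoc, le_div_iff₀ hti]
    linarith
  exact ⟨key true, key false⟩
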